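/- Let $q$ be a power of an odd prime $p$, let $X$ be a finite-dimensional vector space over $\mathbb F_q$ with dual space $X^*$, and let $V=X\oplus X^*$ with the symplectic form $[x\oplus y,x'\oplus y']=y'(x)-y(x')$. For $m\in\mathbb F_q^\times$ put $\omega^{(m)}(\lambda)=e^{\frac{2\pi i}{p}\operatorname{Tr}(m\lambda)}$, where $\operatorname{Tr}$ is the trace $\mathbb F_q\to\mathbb F_p$. The oscillator representation $\mu_V^{(m)}$ of mass $m$ is the representation of $\mathrm{Sp}(V)$ on the space $L^2(X^*)$ of complex functions on $X^*$ that is determined by its values on the following generators: $$\mu_V^{(m)}\begin{pmatrix}1&A\\0&1\end{pmatrix}\delta_y=\omega^{(m)}\big(2^{-1}A(y,y)\big)\delta_y$$ for $A:X^*\to X$ symmetric; $$\mu_V^{(m)}\begin{pmatrix}0&B\\-B^{-1}&0\end{pmatrix}\delta_y=\gamma(B)^{-1}\sum_{y'\in X^*}\omega^{(m)}\big(B(y,y')\big)\delta_{y'},\qquad \gamma(B)=\sum_{y\in X^*}\omega^{(m)}\big(-2^{-1}B(y,y)\big)$$ for $B:X^*\to X$ symmetric and invertible; and $$\mu_V^{(m)}\begin{pmatrix}C&0\\0&C^{-t}\end{pmatrix}\delta_y=\Big(\frac{\det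 C}{q}\Big)\,\delta_{C^{-t}y}$$ for $C\in GL(X)$. Here $A(y,y')=y'(Ay)$. The Heisenberg group $H(V)=\mathbb F_q\times V$ has the group law $(\lambda,v)(\lambda',v')=(\lambda+\lambda'+2^{-1}[v,v'],\,v+v')$. Its Weyl representation of mass $m$ on $L^2(X^*)$ is $$W_V^{(m)}(\lambda,x\oplus y)\delta_z=\omega^{(m)}\big(2^{-1}y(x)+z(x)+\lambda\big)\delta_{z+y}.$$ The Jacobi group over $V$ is $H(V)\rtimes\mathrm{Sp}(V)$ with $S(\lambda,v)S^{-1}=(\lambda,Sv)$. Its Clifford representation on $L^2(X^*)$ is $\mathcal{C}l_V^{(m)}(\lambda,v,S)=W_V^{(m)}(\lambda,v)\,\mu_V^{(m)}(S)$. The superscript is omitted for $m=1$. Let $U$ be a finite-dimensional $\mathbb F_q$-vector space with a non-degenerate symmetric bilinear form $\beta$. Then $U\otimes V=(U\otimes X)\oplus \mathrm{Hom}(X,U)$, with the pairing $\langle u\otimes x,G\rangle=\beta(u,Gx)$, is again a symplectic space. So it carries in the same way a Weyl representation $W_{U\otimes V}$ and an oscillator representation $\mu_{U\otimes V}$ (of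 mass $1$) on $L^2(\mathrm{Hom}(X,U))$. Write $\mu_{U\otimes V}$ also for the restriction to $\mathrm{Sp}(V)$ along $S\mapsto 1\otimes S$. For $u\in U$ let $$\mathcal{C}l^{(u)}_{U\otimes V}(\lambda,v,S)=W_{U\otimes V}\big(\beta(u,u)\lambda,\,u\otimes v\big)\,\mu_{U\otimes V}(S),$$ a representation of the Jacobi group over $V$ on $L^2(\mathrm{Hom}(X,U))$. **Proposition.** 1. Let $u\in U$ be non-isotropic, that is $\beta(u,u)\ne0$, and let $U'=u^\perp$. There is a one-to-one, inclusion-preserving (in both directions) correspondence between the subspaces $\mathcal K\subset L^2(\mathrm{Hom}(X,U'))$ that are invariant under $\mathrm{Sp}(V)$ acting via $\mu_{U'\otimes V}$ and the subspaces $\mathcal K'\subset L^2(\mathrm{Hom}(X,U))$ that are invariant under the Jacobi group over $V$ acting via $\mathcal{C}l^{(u)}_{U\otimes V}$. It is given by $\mathcal K\mapsto\mathcal K'=L^2(X^*)\otimes\mathcal K$, that is, $\mathcal K'$ is the span of the functions $u\otimes y+G\mapsto\varphi(y)\,k(G)$ (for $y\in X^*$, $G\in\mathrm{Hom}(X,U')$)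 with $\varphi\in L^2(X^*)$ and $k\in\mathcal K$. 2. Let $t\ge2$ be an integer that $p$ does not divide. There is a one-to-one, inclusion-preserving (in both directions) correspondence between the subrepresentations of the representation $\mu_V^{\otimes(t-2)}\otimes\mu_V^{(t)}$ of $\mathrm{Sp}(V)$ and the subrepresentations of the $t$-th tensor power $\mathcal{C}l_V^{\otimes t}$ of the Clifford representation of the Jacobi group, under which a subrepresentation is irreducible if and only if its image is irreducible. In particular, the irreducible subrepresentations of the two representations are in one-to-one correspondence. -/

import Mathlib

namespace OscillatorRep

open scoped TensorProduct

set_option linter.unusedSectionVars false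

noncomputable section

section Polarized

variable {F X Y : Type*} [Field F] [AddCommGroup X] [Module F X] [AddCommGroup Y] [Module F Y]

/-- The symplectic form `[x ⊕ y, x' ⊕ y'] = ⟨x, y'⟩ - ⟨x', y⟩` on `X ⊕ Y`, where `X` and `Y` are in
duality through the pairing `B`. -/
def sympForm (B : X →ₗ[F] Y →ₗ[F] F) (v w : X × Y) : F := B v.1 w.2 - B w.1 v.2

/-- The symplectic group of `X ⊕ Y`. -/
def SpGroup (B : X →ₗ[F] Y →ₗ[F] F) : Subgroup ((X × Y) ≃ₗ[F] (X × Y)) where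
  carrier := {S | ∀ v w, sympForm B (S v) (S w) = sympForm B v w}
  one_mem' := fun _ _ => rfl
  mul_mem' := fun {S T} hS hT v w => by
    simpa [LinearEquiv.mul_apply] using (hS (T v) (T w)).trans (hT v w)
  inv_mem' := fun {S} hS v w => by
    have h := hS (S⁻¹ v) (S⁻¹ w)
    have e : ∀ u, S (S⁻¹ u) = u := fun u => S.apply_symm_apply u
    rw [e, e] at h
    exact h.symm

/-- The Heisenberg group of `X ⊕ Y`: the set `F × (X ⊕ Y)` with the group law
`(c, v) (c', v') = (c + c' + [v, v'] / 2, v + v')`. -/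
@[ext]
structure Heisenberg (B : X →ₗ[F] Y →ₗ[F] F) where
  c : F
  v : X × Y

instance (B : X →ₗ[F] Y →ₗ[F] F) : Mul (Heisenberg B) :=
  ⟨fun g h => ⟨g.c + h.c + 2⁻¹ * sympForm B g.v h.v, g.v + h.v⟩⟩

instance (B : X →ₗ[F] Y →ₗ[F] F) : One (Heisenberg B) := ⟨⟨0, 0⟩⟩

instance (B : X →ₗ[F] Y →ₗ[F] F) : Inv (Heisenberg B) := ⟨fun g => ⟨-g.c, -g.v⟩⟩

theorem heis_mul (B : X →ₗ[F] Y →ₗ[F] F) (g h : Heisenberg B) :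
    g * h = ⟨g.c + h.c + 2⁻¹ * sympForm B g.v h.v, g.v + h.v⟩ := rfl

theorem heis_one (B : X →ₗ[F] Y →ₗ[F] F) : (1 : Heisenberg B) = ⟨0, 0⟩ := rfl

instance (B : X →ₗ[F] Y →ₗ[F] F) : Group (Heisenberg B) :=
  Group.ofLeftAxioms
    (fun a b c => by
      ext <;> simp [heis_mul, sympForm, add_assoc]
      ring)
    (fun a => by ext <;> simp [heis_mul, heis_one, sympForm])
    (fun a => by
      change (⟨-a.c, -a.v⟩ : Heisenberg B) * a = 1
      ext <;> simp [heis_mul, heis_one, sympForm])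

/-- The action of the symplectic group on the Heisenberg group by automorphisms,
`S (c, v) S⁻¹ = (c, S v)`. -/
def heisAction (B : X →ₗ[F] Y →ₗ[F] F) : SpGroup B →* MulAut (Heisenberg B) where
  toFun S :=
    { toFun := fun g => ⟨g.c, S.1 g.v⟩
      invFun := fun g => ⟨g.c, S.1.symm g.v⟩
      left_inv := fun g => by simp
      right_inv := fun g => by simp
      map_mul' := fun g h => by simp [heis_mul, S.2 g.v h.v] }
  map_one' := rfl
  map_mul' := fun _ _ => rfl

/-- The Jacobi group, the semidirect product of the Heisenberg and the symplectic group. -/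
abbrev Jacobi (B : X →ₗ[F] Y →ₗ[F] F) := Heisenberg B ⋊[heisAction B] SpGroup B

/-- The Weyl representation of the Heisenberg group on the functions on `Y`, with central character
`ψ`: `W(c, x ⊕ y)` maps the delta function at `z` to
`ψ(⟨x, y⟩ / 2 + ⟨x, z⟩ + c)` times the delta function at `z + y`. -/
def weyl (B : X →ₗ[F] Y →ₗ[F] F) (ψ : AddChar F ℂ) [NeZero (2 : F)] :
    Representation ℂ (Heisenberg B) (Y → ℂ) where
  toFun g :=
    { toFun := fun f z => ψ (g.c + B g.v.1 z - 2⁻¹ * B g.v.1 g.v.2) * f (z - g.v.2)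
      map_add' := fun f f' => by ext z; simp [mul_add]
      map_smul' := fun a f => by ext z; simp; ring }
  map_one' := by ext f z; simp [heis_one]
  map_mul' := fun g h => by
    refine LinearMap.ext fun f => funext fun z => ?_
    have h2 : (2 : F) ≠ 0 := NeZero.ne 2
    simp only [heis_mul, LinearMap.coe_mk, AddHom.coe_mk, Module.End.mul_apply, sympForm]
    rw [← mul_assoc, ← AddChar.map_add_eq_mul, sub_sub]
    congr 2
    simp
    field_simp
    ring

theorem weyl_apply (B : X →ₗ[F] Y →ₗ[F] F) (ψ : AddChar F ℂ) [NeZero (2 : F)] (g : Heisenberg B)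
    (f : Y → ℂ) (z : Y) : weyl B ψ g f z
      = ψ (g.c + B g.v.1 z - 2⁻¹ * B g.v.1 g.v.2) * f (z - g.v.2) := rfl

end Polarized

section Parity

variable {F Y : Type*} [Field F] [AddCommGroup Y] [Module F Y]

/-- Composition of functions with a map. -/
def pull (D : Y → Y) : Module.End ℂ (Y → ℂ) := LinearMap.funLeft ℂ ℂ D

/-- Multiplication by a function. -/
def mulBy (f : Y → ℂ) : Module.End ℂ (Y → ℂ) := LinearMap.mulLeft ℂ f

/-- The parity operator. -/
def par : Module.End ℂ (Y → ℂ) := pull (fun y : Y => -y)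

theorem pull_apply (D : Y → Y) (f : Y → ℂ) (z : Y) : pull D f z = f (D z) := rfl

theorem mulBy_apply (f g : Y → ℂ) (z : Y) : mulBy f g z = f z * g z := rfl

theorem par_apply (f : Y → ℂ) (z : Y) : par f z = f (-z) := rfl

theorem par_mul_par : (par * par : Module.End ℂ (Y → ℂ)) = 1 := by
  ext f z; simp [par_apply]

/-- The projection onto the even functions. -/
def evenP : Module.End ℂ (Y → ℂ) := (2⁻¹ : ℂ) • (1 + par)

/-- The projection onto the odd functions. -/
def oddP : Module.End ℂ (Y → ℂ) := (2⁻¹ : ℂ) • (1 - par)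

theorem evenP_apply (f : Y → ℂ) (z : Y) : evenP f z = 2⁻¹ * (f z + f (-z)) := rfl

theorem oddP_apply (f : Y → ℂ) (z : Y) : oddP f z = 2⁻¹ * (f z - f (-z)) := rfl

theorem evenP_add_oddP : (evenP + oddP : Module.End ℂ (Y → ℂ)) = 1 := by
  refine LinearMap.ext fun f => funext fun z => ?_
  simp [evenP_apply, oddP_apply]; ring

theorem evenP_mul_oddP : (evenP * oddP : Module.End ℂ (Y → ℂ)) = 0 := by
  refine LinearMap.ext fun f => funext fun z => ?_
  simp [evenP_apply, oddP_apply]; ring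

theorem oddP_mul_evenP : (oddP * evenP : Module.End ℂ (Y → ℂ)) = 0 := by
  refine LinearMap.ext fun f => funext fun z => ?_
  simp [evenP_apply, oddP_apply]; ring

theorem evenP_mul_evenP : (evenP * evenP : Module.End ℂ (Y → ℂ)) = evenP := by
  refine LinearMap.ext fun f => funext fun z => ?_
  simp [evenP_apply]; ring

theorem oddP_mul_oddP : (oddP * oddP : Module.End ℂ (Y → ℂ)) = oddP := by
  refine LinearMap.ext fun f => funext fun z => ?_
  simp [oddP_apply]; ring

/-- For an operator that commutes with the parity, the quotient of its determinants on the even and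
on the odd functions. -/
def sdet (R : Module.End ℂ (Y → ℂ)) : ℂ :=
  LinearMap.det (R * evenP + oddP) / LinearMap.det (evenP + R * oddP)

theorem commute_evenP {R : Module.End ℂ (Y → ℂ)} (h : Commute R par) : Commute R evenP :=
  (((Commute.one_right R).add_right h).smul_right _)

theorem commute_oddP {R : Module.End ℂ (Y → ℂ)} (h : Commute R par) : Commute R oddP :=
  (((Commute.one_right R).sub_right h).smul_right _)

theorem sdet_mul {R R' : Module.End ℂ (Y → ℂ)} (h' : Commute R' par) :
    sdet (R * R') = sdet R * sdet R' := by
  have e1 : (R * evenP + oddP) * (R' * evenP + oddP) = R * R' * evenP + oddP := by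
    have a := (commute_evenP h').eq
    have b := (commute_oddP h').eq
    calc _ = R * (evenP * R') * evenP + R * (evenP * oddP) + oddP * R' * evenP + oddP * oddP := by
          noncomm_ring
      _ = _ := by
          rw [← a, evenP_mul_oddP, ← b, mul_assoc R' oddP, oddP_mul_evenP, oddP_mul_oddP,
            ← mul_assoc R, mul_assoc (R * R'), evenP_mul_evenP]
          simp
  have e2 : (evenP + R * oddP) * (evenP + R' * oddP) = evenP + R * R' * oddP := by
    have a := (commute_evenP h').eq
    have b := (commute_oddP h').eq
    calc _ = R * (oddP * R') * oddP + R * (oddP * evenP) + evenP * R' * oddP + evenP * evenP := by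
          noncomm_ring
      _ = _ := by
          rw [← a, oddP_mul_evenP, ← b, mul_assoc R' evenP, evenP_mul_oddP, evenP_mul_evenP,
            ← mul_assoc R, mul_assoc (R * R'), oddP_mul_oddP]
          simp [add_comm]
  rw [sdet, ← e1, ← e2, map_mul, map_mul, sdet, sdet, mul_div_mul_comm]

theorem sdet_one : sdet (1 : Module.End ℂ (Y → ℂ)) = 1 := by
  simp [sdet, evenP_add_oddP]

theorem commute_par_mulBy {f : Y → ℂ} (hf : ∀ y, f (-y) = f y) : Commute (mulBy f) par := by
  refine LinearMap.ext fun g => funext fun z => ?_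
  simp [mulBy_apply, par_apply, hf]

theorem commute_par_pull (D : Module.End F Y) : Commute (pull D) par := by
  refine LinearMap.ext fun g => funext fun z => ?_
  simp [pull_apply, par_apply]

variable [NeZero (2 : F)]

theorem neg_ne_self' (F : Type*) [Field F] [NeZero (2 : F)] [Module F Y] {y : Y} (h : y ≠ 0) :
    -y ≠ y := by
  intro e
  have : (2 : F) • y = 0 := by
    rw [two_smul]; nth_rewrite 1 [← e]; simp
  exact h ((smul_eq_zero.1 this).resolve_left (NeZero.ne _))

theorem exists_sign (F Y : Type*) [Field F] [AddCommGroup Y] [Module F Y] [NeZero (2 : F)] :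
    ∃ e : Y → ℂ, e 0 = 0 ∧ (∀ y, e (-y) = - e y) ∧ ∀ y, y ≠ 0 → e y * e y = 1 := by
  classical
  obtain ⟨r⟩ : Nonempty (LinearOrder Y) := ⟨linearOrderOfSTO WellOrderingRel⟩
  refine ⟨fun y => if y = 0 then 0 else if y < -y then 1 else -1, by simp, fun y => ?_, fun y h => ?_⟩
  · by_cases h : y = 0
    · simp [h]
    · rcases lt_or_gt_of_ne (neg_ne_self' F h) with h1 | h1
      · simp [h, h1, h1.not_gt]
      · simp [h, h1, h1.not_gt]
  · simp only [h, if_false]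
    split_ifs <;> simp

/-- The operator used to compare the even and the odd functions. -/
theorem exists_swap (F Y : Type*) [Field F] [AddCommGroup Y] [Module F Y] [NeZero (2 : F)] :
    ∃ q : Y → ℂ, ∃ Q e0 : Module.End ℂ (Y → ℂ), Q = mulBy q ∧ (∀ y, q y * q y = 1) ∧
      (∀ y, y ≠ 0 → q (-y) = - q y) ∧ q 0 = 1 ∧
      e0 = mulBy (fun y => by classical exact if y = 0 then 1 else 0) ∧ Q * Q = 1 ∧
      Q * oddP * Q = evenP - e0 ∧ Q * evenP * Q = oddP + e0 := by
  classical
  obtain ⟨e, h0, h1, h2⟩ := exists_sign F Y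
  let q : Y → ℂ := fun y => if y = 0 then 1 else e y
  have hq : ∀ y, q y * q y = 1 := fun y => by
    by_cases h : y = 0
    · simp [q, h]
    · simpa [q, h] using h2 y h
  refine ⟨q, mulBy q, _, rfl, hq, fun y h => by simp [q, h, h1], by simp [q], rfl, ?_, ?_, ?_⟩
  · refine LinearMap.ext fun g => funext fun z => ?_
    simp [mulBy_apply, ← mul_assoc, hq]
  · refine LinearMap.ext fun g => funext fun z => ?_
    by_cases h : z = 0
    · subst h
      simp [mulBy_apply, oddP_apply, evenP_apply, q]
      ring
    · have := h2 z h
      simp [mulBy_apply, oddP_apply, evenP_apply, q, h, h1]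
      linear_combination (2⁻¹ * (g z + g (-z))) * this
  · refine LinearMap.ext fun g => funext fun z => ?_
    by_cases h : z = 0
    · subst h
      simp [mulBy_apply, oddP_apply, evenP_apply, q]
      ring
    · have := h2 z h
      simp [mulBy_apply, oddP_apply, evenP_apply, q, h, h1]
      linear_combination (2⁻¹ * (g z - g (-z))) * this

theorem det_mulBy [Fintype Y] (f : Y → ℂ) : LinearMap.det (mulBy f) = ∏ y, f y := by
  classical
  rw [← LinearMap.det_toMatrix (Pi.basisFun ℂ Y)]
  have : LinearMap.toMatrix (Pi.basisFun ℂ Y) (Pi.basisFun ℂ Y) (mulBy f) = Matrix.diagonal f := by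
    ext i j
    simp [mulBy_apply, Matrix.diagonal_apply, Pi.single_apply]
  rw [this, Matrix.det_diagonal]

theorem det_conj_Q {Q R : Module.End ℂ (Y → ℂ)} (hQ : Q * Q = 1) :
    LinearMap.det (Q * R * Q) = LinearMap.det R := by
  rw [map_mul, map_mul]
  have : LinearMap.det Q * LinearMap.det Q = 1 := by rw [← map_mul, hQ, map_one]
  linear_combination (LinearMap.det R) * this

theorem sdet_mulBy (F : Type*) [Field F] [NeZero (2 : F)] [Module F Y] [Finite Y]
    {f : Y → ℂ} (hf : ∀ y, f (-y) = f y) (hne : ∀ y, f y ≠ 0) : sdet (mulBy f) = f 0 := by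
  classical
  cases nonempty_fintype Y
  obtain ⟨q, Q, e0, hQ, hq, hqn, hq0, he0, hQQ, h1, h2⟩ := exists_swap F Y
  have e1 : Q * (evenP + mulBy f * oddP) * Q = mulBy f * (evenP - e0) + (oddP + e0) := by
    have c : Q * mulBy f = mulBy f * Q := by
      subst hQ
      refine LinearMap.ext fun g => funext fun z => ?_
      simp [mulBy_apply]; ring
    calc _ = Q * evenP * Q + (Q * mulBy f) * oddP * Q := by noncomm_ring
      _ = Q * evenP * Q + mulBy f * (Q * oddP * Q) := by rw [c]; noncomm_ring
      _ = _ := by rw [h1, h2, add_comm]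
  have e2 : mulBy f * evenP + oddP = (mulBy f * (evenP - e0) + (oddP + e0)) *
      mulBy (fun y => if y = 0 then f 0 else 1) := by
    subst he0
    refine LinearMap.ext fun g => funext fun z => ?_
    by_cases h : z = 0
    · subst h
      simp [mulBy_apply, oddP_apply, evenP_apply]
      try ring
    · simp [mulBy_apply, oddP_apply, evenP_apply, h]
  have e3 : LinearMap.det (mulBy (fun y : Y => if y = 0 then f 0 else 1)) = f 0 := by
    rw [det_mulBy]; simp
  have c := commute_par_mulBy hf
  have hunit : LinearMap.det (evenP + mulBy f * oddP) ≠ 0 := by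
    have : (evenP + mulBy f * oddP) * (evenP + mulBy (fun y => (f y)⁻¹) * oddP) = 1 := by
      refine LinearMap.ext fun g => funext fun z => ?_
      have := hne z
      simp [mulBy_apply, oddP_apply, evenP_apply, hf]
      field_simp
      ring
    intro h0
    have h3 := congrArg LinearMap.det this
    rw [map_mul, h0, map_one] at h3
    simp at h3
  rw [sdet, div_eq_iff hunit, e2, map_mul, e3, ← e1, det_conj_Q hQQ, mul_comm]

theorem smul_eq_mulBy (c : ℂ) : (c • 1 : Module.End ℂ (Y → ℂ)) = mulBy (fun _ => c) := by
  ext; simp [mulBy_apply]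

theorem sdet_smul (F : Type*) [Field F] [NeZero (2 : F)] [Module F Y] [Finite Y]
    {c : ℂ} (hc : c ≠ 0) {R : Module.End ℂ (Y → ℂ)} (h : Commute R par) :
    sdet (c • R) = c * sdet R := by
  have : c • R = (c • 1) * R := by simp
  rw [this, sdet_mul h, smul_eq_mulBy, sdet_mulBy F (fun _ => rfl) (fun _ => hc)]

theorem sdet_ne_zero {R : Module.End ℂ (Y → ℂ)} [Finite Y] (h : Commute R par)
    (hinj : Function.Injective R) : sdet R ≠ 0 := by
  have hu : IsUnit R := (Module.End.isUnit_iff _).2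
    ⟨hinj, LinearMap.injective_iff_surjective.1 hinj⟩
  obtain ⟨u, rfl⟩ := hu
  have : Commute (↑u⁻¹ : Module.End ℂ (Y → ℂ)) par := h.units_inv_left
  intro h0
  have h1 := sdet_mul (R := ↑u) this
  rw [Units.mul_inv, sdet_one, h0] at h1
  simp at h1

end Parity

section Intertwiners

variable {F X Y : Type*} [Field F] [AddCommGroup X] [Module F X] [AddCommGroup Y] [Module F Y]
  [NeZero (2 : F)] (B : X →ₗ[F] Y →ₗ[F] F) (ψ : AddChar F ℂ)

/-- The Weyl operators. -/
def weylOp (v : X × Y) : Module.End ℂ (Y → ℂ) := weyl B ψ ⟨0, v⟩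

theorem weylOp_apply (v : X × Y) (f : Y → ℂ) (z : Y) :
    weylOp B ψ v f z = ψ (B v.1 z - 2⁻¹ * B v.1 v.2) * f (z - v.2) := by
  rw [weylOp, weyl_apply]; simp

theorem weyl_eq (g : Heisenberg B) : weyl B ψ g = ψ g.c • weylOp B ψ g.v := by
  refine LinearMap.ext fun f => funext fun z => ?_
  simp only [LinearMap.smul_apply, Pi.smul_apply, weylOp_apply, weyl_apply, smul_eq_mul]
  rw [← mul_assoc, ← AddChar.map_add_eq_mul, add_sub_assoc]

theorem weylOp_mul (v w : X × Y) :
    weylOp B ψ v * weylOp B ψ w = ψ (2⁻¹ * sympForm B v w) • weylOp B ψ (v + w) := by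
  rw [weylOp, weylOp, ← map_mul, heis_mul, weyl_eq]
  simp

/-- The operator `R` intertwines the Weyl operators according to `S`. -/
def Intertwines (S : SpGroup B) (R : Module.End ℂ (Y → ℂ)) : Prop :=
  ∀ v, R * weylOp B ψ v = weylOp B ψ (S.1 v) * R

theorem sum_char {M : Type*} [AddCommGroup M] [Module F M] [Fintype M] (hψ : ψ ≠ 1)
    {l : M →ₗ[F] F} (hl : l ≠ 0) : ∑ m, ψ (l m) = 0 := by
  classical
  have h : ψ.compAddMonoidHom l.toAddMonoidHom ≠ 0 := by
    intro h
    apply hψ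
    obtain ⟨m, hm⟩ : ∃ m, l m ≠ 0 := by
      by_contra! h'
      exact hl (LinearMap.ext h')
    ext a
    have := congrArg (fun χ : AddChar M ℂ => χ ((a * (l m)⁻¹) • m)) h
    simpa [hm] using this
  have := AddChar.sum_eq_ite (ψ.compAddMonoidHom l.toAddMonoidHom)
  rw [if_neg h] at this
  simpa using this

variable {B ψ}

theorem end_eq_zero_of_single [DecidableEq Y] [Finite Y] {R : Module.End ℂ (Y → ℂ)}
    (h : ∀ z, R (Pi.single z 1) = 0) : R = 0 := by
  cases nonempty_fintype Y
  refine (Pi.basisFun ℂ Y).ext fun z => ?_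
  simpa using h z

/-- A nonzero operator that intertwines is injective. -/
theorem Intertwines.injective [Finite X] [Finite Y] (hB : B.Nondegenerate) (hψ : ψ ≠ 1)
    {S : SpGroup B} {R : Module.End ℂ (Y → ℂ)} (hR : Intertwines B ψ S R) (h0 : R ≠ 0) :
    Function.Injective R := by
  classical
  cases nonempty_fintype X
  cases nonempty_fintype Y
  have hk : ∀ f, R f = 0 → ∀ v, R (weylOp B ψ v f) = 0 := fun f hf v => by
    have := LinearMap.congr_fun (hR v) f
    simp only [Module.End.mul_apply] at this
    rw [this, hf, map_zero]
  refine (injective_iff_map_eq_zero R).2 fun f hf => ?_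
  by_contra hne
  obtain ⟨z0, hz0⟩ := Function.ne_iff.1 hne
  apply h0
  have h1 : ∑ x : X, ψ (- B x z0) • weylOp B ψ (x, 0) f
      = (Fintype.card X * f z0 : ℂ) • Pi.single z0 1 := by
    ext z
    simp only [Finset.sum_apply, Pi.smul_apply, weylOp_apply, smul_eq_mul, map_zero, mul_zero,
      sub_zero, ← mul_assoc, ← AddChar.map_add_eq_mul]
    by_cases hz : z = z0
    · subst hz
      simp
    · rw [← Finset.sum_mul]
      have : ∑ x : X, ψ (- B x z0 + B x z) = 0 := by
        have := sum_char ψ hψ (l := B.flip (z - z0)) (by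
          intro h
          apply hz
          have := hB.2 (z - z0) (fun x => by simpa using LinearMap.congr_fun h x)
          exact sub_eq_zero.1 this)
        rw [← this]
        refine Finset.sum_congr rfl fun x _ => ?_
        congr 1
        simp
        ring
      rw [this]
      simp [hz]
  have h2 : R (Pi.single z0 1) = 0 := by
    have h3 : R (∑ x : X, ψ (- B x z0) • weylOp B ψ (x, 0) f) = 0 := by
      simp [hk f hf]
    rw [h1, map_smul, smul_eq_zero] at h3
    refine h3.resolve_left ?_
    have : (Fintype.card X : ℂ) ≠ 0 := by exact_mod_cast Fintype.card_ne_zero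
    exact mul_ne_zero this hz0
  refine end_eq_zero_of_single fun z => ?_
  have h3 := hk _ h2 (0, z - z0)
  convert h3 using 2
  ext w
  rw [weylOp_apply]
  simp only [map_zero, LinearMap.zero_apply, mul_zero, sub_zero, AddChar.map_zero_eq_one, one_mul,
    Pi.single_apply]
  congr 1
  rw [sub_sub_eq_add_sub, sub_eq_iff_eq_add, add_comm z0 z, add_left_inj]

/-- Schur's lemma for the Weyl operators. -/
theorem schur [Finite X] [Finite Y] (hB : B.Nondegenerate) (hψ : ψ ≠ 1)
    {R : Module.End ℂ (Y → ℂ)} (hR : Intertwines B ψ 1 R) : ∃ c : ℂ, R = c • 1 := by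
  obtain ⟨c, hc⟩ := Module.End.exists_eigenvalue R
  refine ⟨c, ?_⟩
  obtain ⟨f, hf⟩ := hc.exists_hasEigenvector
  by_contra h
  have h0 : R - c • 1 ≠ 0 := sub_ne_zero.2 h
  have hI : Intertwines B ψ 1 (R - c • 1) := fun v => by
    have := hR v
    simp only [sub_mul, mul_sub, this]
    simp
  have := Intertwines.injective hB hψ hI h0
  have h1 : (R - c • 1) f = 0 := by
    simp [hf.apply_eq_smul]
  exact hf.2 (this (h1.trans (map_zero _).symm))

theorem Intertwines.mul {S S' : SpGroup B} {R R' : Module.End ℂ (Y → ℂ)}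
    (h : Intertwines B ψ S R) (h' : Intertwines B ψ S' R') : Intertwines B ψ (S * S') (R * R') := by
  intro v
  rw [mul_assoc, h' v, ← mul_assoc, h, mul_assoc]
  rfl

theorem Intertwines.smul {S : SpGroup B} {R : Module.End ℂ (Y → ℂ)}
    (h : Intertwines B ψ S R) (c : ℂ) : Intertwines B ψ S (c • R) := by
  intro v
  rw [smul_mul_assoc, h v, mul_smul_comm]

theorem Intertwines.eq_smul [Finite X] [Finite Y] (hB : B.Nondegenerate) (hψ : ψ ≠ 1)
    {S : SpGroup B} {R T : Module.End ℂ (Y → ℂ)} (hR : Intertwines B ψ S R)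
    (hT : Intertwines B ψ S T) (h0 : T ≠ 0) : ∃ c : ℂ, R = c • T := by
  have hinj := Intertwines.injective hB hψ hT h0
  have hu : IsUnit T := (Module.End.isUnit_iff _).2
    ⟨hinj, LinearMap.injective_iff_surjective.1 hinj⟩
  obtain ⟨u, rfl⟩ := hu
  have hI : Intertwines B ψ 1 ((↑u⁻¹ : Module.End ℂ (Y → ℂ)) * R) := by
    intro v
    change _ = weylOp B ψ v * _
    have h1 : (↑u⁻¹ : Module.End ℂ (Y → ℂ)) * weylOp B ψ (S.1 v) = weylOp B ψ v * ↑u⁻¹ := by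
      have := hT v
      calc _ = ↑u⁻¹ * (weylOp B ψ (S.1 v) * ↑u) * ↑u⁻¹ := by simp [mul_assoc]
        _ = _ := by rw [← this]; simp [← mul_assoc]
    rw [mul_assoc, hR v, ← mul_assoc, h1, mul_assoc]
  obtain ⟨c, hc⟩ := schur hB hψ hI
  refine ⟨c, ?_⟩
  have := congrArg (fun A => (u : Module.End ℂ (Y → ℂ)) * A) hc
  simpa using this

variable (B ψ)

/-- An explicit nonzero operator that intertwines. -/
def bigT [Fintype X] [Fintype Y] (S : SpGroup B) : Module.End ℂ (Y → ℂ) :=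
  ∑ v : X × Y, weylOp B ψ (S.1 v) * weylOp B ψ (-v)

theorem bigT_intertwines [Fintype X] [Fintype Y] (S : SpGroup B) :
    Intertwines B ψ S (bigT B ψ S) := by
  intro a
  rw [bigT, Finset.sum_mul, Finset.mul_sum]
  refine Fintype.sum_equiv (Equiv.subRight a) _ _ fun v => ?_
  rw [mul_assoc, weylOp_mul, ← mul_assoc, weylOp_mul, mul_smul_comm, smul_mul_assoc]
  have hS := S.2 a (v - a)
  simp only [Equiv.subRight_apply]
  rw [hS]
  have e1 : S.1 a + S.1 (v - a) = S.1 v := by rw [← map_add]; congr 1; abel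
  have e2 : -v + a = -(v - a) := by abel
  rw [e1, e2]
  congr 2
  simp only [sympForm, Prod.fst_sub, Prod.snd_sub, Prod.fst_neg, Prod.snd_neg, map_sub, map_neg,
    LinearMap.sub_apply, LinearMap.neg_apply]
  ring

theorem par_mul_weylOp (v : X × Y) : par * weylOp B ψ v = weylOp B ψ (-v) * par := by
  refine LinearMap.ext fun f => funext fun z => ?_
  simp only [Module.End.mul_apply, par_apply, weylOp_apply]
  congr 2
  · simp
  · simp; abel

theorem bigT_commute [Fintype X] [Fintype Y] (S : SpGroup B) : Commute (bigT B ψ S) par := by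
  symm
  change par * _ = _ * par
  rw [bigT, Finset.sum_mul, Finset.mul_sum]
  refine Fintype.sum_equiv (Equiv.neg _) _ _ fun v => ?_
  rw [← mul_assoc, par_mul_weylOp, mul_assoc, par_mul_weylOp, ← mul_assoc]
  simp

theorem trace_weylOp [Fintype Y] (hB : B.Nondegenerate) (hψ : ψ ≠ 1) (v : X × Y) :
    LinearMap.trace ℂ _ (weylOp B ψ v) = by classical exact if v = 0 then (Fintype.card Y : ℂ) else 0 := by
  classical
  rw [LinearMap.trace_eq_matrix_trace ℂ (Pi.basisFun ℂ Y), Matrix.trace]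
  simp only [Matrix.diag_apply, LinearMap.toMatrix_apply, Pi.basisFun_apply, Pi.basisFun_repr,
    weylOp_apply, Pi.single_apply]
  by_cases h2 : v.2 = 0
  · by_cases h1 : v.1 = 0
    · have : v = 0 := Prod.ext h1 h2
      subst this
      simp
    · have : v ≠ 0 := fun h => h1 (by rw [h]; rfl)
      rw [if_neg this]
      simp only [h2, map_zero, mul_zero, sub_zero, if_true, mul_one]
      refine sum_char ψ hψ fun h => h1 (hB.1 _ fun y => by simp [h])
  · have : v ≠ 0 := fun h => h2 (by rw [h]; rfl)
    rw [if_neg this]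
    refine Finset.sum_eq_zero fun z _ => ?_
    simp [h2]

theorem bigT_ne_zero [Fintype X] [Fintype Y] (hB : B.Nondegenerate) (hψ : ψ ≠ 1) (S : SpGroup B) :
    bigT B ψ S ≠ 0 := by
  classical
  intro h
  have h1 : LinearMap.trace ℂ _ (bigT B ψ S)
      = ∑ v : X × Y, if S.1 v = v then (Fintype.card Y : ℂ) else 0 := by
    rw [bigT, map_sum]
    refine Finset.sum_congr rfl fun v _ => ?_
    rw [weylOp_mul, map_smul, trace_weylOp B ψ hB hψ]
    by_cases hv : S.1 v = v
    · simp [hv, sympForm]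
    · simp [hv, ← sub_eq_add_neg, sub_eq_zero]
  rw [h, map_zero, ← Finset.sum_filter, Finset.sum_const, nsmul_eq_mul] at h1
  have h2 : (Fintype.card Y : ℂ) ≠ 0 := by exact_mod_cast Fintype.card_ne_zero
  have h3 := (mul_eq_zero.1 h1.symm).resolve_right h2
  rw [Nat.cast_eq_zero, Finset.card_eq_zero] at h3
  have : (0 : X × Y) ∈ Finset.univ.filter fun v : X × Y => S.1 v = v := by simp
  rw [h3] at this
  simp at this

/-- The operator with the correct normalization. -/
def oscFun [Fintype X] [Fintype Y] (S : SpGroup B) : Module.End ℂ (Y → ℂ) :=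
  (sdet (bigT B ψ S))⁻¹ • bigT B ψ S

theorem sdet_bigT [Fintype X] [Fintype Y] (hB : B.Nondegenerate) (hψ : ψ ≠ 1) (S : SpGroup B) :
    sdet (bigT B ψ S) ≠ 0 :=
  sdet_ne_zero (bigT_commute B ψ S)
    ((bigT_intertwines B ψ S).injective hB hψ (bigT_ne_zero B ψ hB hψ S))

theorem oscFun_intertwines [Fintype X] [Fintype Y] (S : SpGroup B) :
    Intertwines B ψ S (oscFun B ψ S) := (bigT_intertwines B ψ S).smul _

theorem oscFun_commute [Fintype X] [Fintype Y] (S : SpGroup B) :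
    Commute (oscFun B ψ S) par := (bigT_commute B ψ S).smul_left _

theorem sdet_oscFun [Fintype X] [Fintype Y] (hB : B.Nondegenerate) (hψ : ψ ≠ 1) (S : SpGroup B) :
    sdet (oscFun B ψ S) = 1 := by
  have := sdet_bigT B ψ hB hψ S
  rw [oscFun, sdet_smul F (inv_ne_zero this) (bigT_commute B ψ S), inv_mul_cancel₀ this]

theorem eq_oscFun [Fintype X] [Fintype Y] (hB : B.Nondegenerate) (hψ : ψ ≠ 1) {S : SpGroup B}
    {R : Module.End ℂ (Y → ℂ)} (hR : Intertwines B ψ S R) (hp : Commute R par)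
    (h1 : sdet R = 1) : oscFun B ψ S = R := by
  have hR0 : R ≠ 0 := by
    rintro rfl
    have hd : LinearMap.det (oddP : Module.End ℂ (Y → ℂ)) = 0 := by
      by_contra hd
      have hu : IsUnit (oddP : Module.End ℂ (Y → ℂ)) := by
        rw [LinearMap.isUnit_iff_isUnit_det]; exact isUnit_iff_ne_zero.2 hd
      have h2 : (evenP : Module.End ℂ (Y → ℂ)) = 0 :=
        hu.mul_left_cancel (by rw [oddP_mul_evenP, mul_zero])
      have h3 := congrFun (LinearMap.congr_fun h2 (fun _ => 1)) 0
      rw [evenP_apply] at h3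
      norm_num at h3
    rw [sdet, zero_mul, zero_add, hd, zero_div] at h1
    exact zero_ne_one h1
  obtain ⟨c, hc⟩ := Intertwines.eq_smul hB hψ (bigT_intertwines B ψ S) hR hR0
  have hc0 : c ≠ 0 := by
    rintro rfl
    exact bigT_ne_zero B ψ hB hψ S (by simpa using hc)
  rw [oscFun, hc, sdet_smul F hc0 hp, h1, smul_smul]
  simp [hc0]

end Intertwiners

section Fourier

variable {F Y : Type*} [Field F] [AddCommGroup Y] [Module F Y] [NeZero (2 : F)]
  (ψ : AddChar F ℂ)

/-- The Fourier transform with respect to a bilinear form. -/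
def four [Fintype Y] (b : Y →ₗ[F] Y →ₗ[F] F) : Module.End ℂ (Y → ℂ) where
  toFun f := fun z' => ∑ z, ψ (b z z') * f z
  map_add' f g := by ext; simp [mul_add, Finset.sum_add_distrib]
  map_smul' c f := by
    ext; simp only [Pi.smul_apply, smul_eq_mul, RingHom.id_apply, Finset.mul_sum]
    exact Finset.sum_congr rfl fun _ _ => by ring

theorem four_apply [Fintype Y] (b : Y →ₗ[F] Y →ₗ[F] F) (f : Y → ℂ) (z' : Y) :
    four ψ b f z' = ∑ z, ψ (b z z') * f z := rfl

/-- The Gauss sum of a bilinear form. -/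
def gam [Fintype Y] (b : Y →ₗ[F] Y →ₗ[F] F) : ℂ := ∑ z, ψ (-(2⁻¹ * b z z))

theorem four_commute [Fintype Y] (b : Y →ₗ[F] Y →ₗ[F] F) : Commute (four ψ b) par := by
  refine LinearMap.ext fun f => funext fun z => ?_
  simp only [Module.End.mul_apply, four_apply, par_apply]
  refine Fintype.sum_equiv (Equiv.neg _) _ _ fun v => ?_
  simp

theorem sdet_zero [Finite Y] : sdet (0 : Module.End ℂ (Y → ℂ)) = 0 := by
  have hd : LinearMap.det (oddP : Module.End ℂ (Y → ℂ)) = 0 := by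
    by_contra hd
    have hu : IsUnit (oddP : Module.End ℂ (Y → ℂ)) := by
      rw [LinearMap.isUnit_iff_isUnit_det]; exact isUnit_iff_ne_zero.2 hd
    have h2 : (evenP : Module.End ℂ (Y → ℂ)) = 0 :=
      hu.mul_left_cancel (by rw [oddP_mul_evenP, mul_zero])
    have h3 := congrFun (LinearMap.congr_fun h2 (fun _ => 1)) 0
    rw [evenP_apply] at h3
    norm_num at h3
  rw [sdet, zero_mul, zero_add, hd, zero_div]

theorem sdet_par [Finite Y] : sdet (par : Module.End ℂ (Y → ℂ)) ≠ 0 := by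
  refine sdet_ne_zero (Commute.refl _) fun f g h => ?_
  ext z
  simpa [par_apply] using congrFun h (-z)

theorem four_neg [Fintype Y] (b : Y →ₗ[F] Y →ₗ[F] F) : four ψ (-b) = par * four ψ b := by
  refine LinearMap.ext fun f => funext fun z => ?_
  simp [four_apply, par_apply]

variable {ψ}

theorem four_injective [Fintype Y] (hψ : ψ ≠ 1) {b : Y →ₗ[F] Y →ₗ[F] F}
    (hs : ∀ z w, b z w = b w z) (hn : ∀ z, (∀ w, b z w = 0) → z = 0) :
    Function.Injective (four ψ b) := by
  classical
  have key : ∀ f z, four ψ b (four ψ b f) z = Fintype.card Y * f (-z) := by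
    intro f z
    simp only [four_apply, Finset.mul_sum]
    rw [Finset.sum_comm, Finset.sum_eq_single (-z)]
    · simp only [← mul_assoc, ← AddChar.map_add_eq_mul]
      simp [hs _ z]
    · intro w _ hw
      simp only [← mul_assoc, ← AddChar.map_add_eq_mul]
      rw [← Finset.sum_mul]
      have := sum_char ψ hψ (l := b (z + w)) (fun h => hw (by
        have := hn (z + w) (fun x => by rw [h]; rfl)
        exact eq_neg_of_add_eq_zero_right this))
      have h2 : ∑ i, ψ (b i z + b w i) = 0 := by
        rw [← this]
        exact Finset.sum_congr rfl fun i _ => by rw [hs i z]; simp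
      rw [h2, zero_mul]
    · simp
  intro f g h
  ext z
  have h1 := key f (-z)
  rw [h, key] at h1
  have : (Fintype.card Y : ℂ) ≠ 0 := by exact_mod_cast Fintype.card_ne_zero
  simpa [this] using h1.symm

theorem sdet_four_aux [Fintype Y] (hψ : ψ ≠ 1) {b : Y →ₗ[F] Y →ₗ[F] F}
    (hs : ∀ z w, b z w = b w z) (hn : ∀ z, (∀ w, b z w = 0) → z = 0) :
    sdet (four ψ b) = gam ψ (-b) * sdet (par : Module.End ℂ (Y → ℂ)) := by
  have h2 : (2 : F) ≠ 0 := NeZero.ne 2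
  let M : Module.End ℂ (Y → ℂ) := mulBy fun z => ψ (2⁻¹ * b z z)
  let M' : Module.End ℂ (Y → ℂ) := mulBy fun z => ψ (-(2⁻¹ * b z z))
  have hM : Commute M par := commute_par_mulBy fun y => by simp
  have hM' : Commute M' par := commute_par_mulBy fun y => by simp
  have sM : sdet M = 1 := by
    rw [sdet_mulBy F (fun y => by simp) (fun y => (ψ.val_isUnit _).ne_zero)]; simp
  have sM' : sdet M' = 1 := by
    rw [sdet_mulBy F (fun y => by simp) (fun y => (ψ.val_isUnit _).ne_zero)]; simp
  have hF := four_commute ψ b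
  have e : four ψ b * (M * four ψ b) = gam ψ (-b) • (M' * (par * (four ψ b * M'))) := by
    refine LinearMap.ext fun f => funext fun z => ?_
    simp only [Module.End.mul_apply, four_apply, par_apply, LinearMap.smul_apply, Pi.smul_apply,
      mulBy_apply, M, M', gam, Finset.mul_sum, smul_eq_mul]
    rw [Finset.sum_comm]
    refine Finset.sum_congr rfl fun w _ => ?_
    rw [Finset.sum_mul]
    refine Fintype.sum_equiv (Equiv.addRight (z + w)) _ _ fun v => ?_
    simp only [← mul_assoc, ← AddChar.map_add_eq_mul]
    congr 2
    simp only [Equiv.coe_addRight, map_add, LinearMap.add_apply, map_neg, LinearMap.neg_apply]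
    rw [hs w v, hs w z, hs z v]
    field_simp
    ring
  have hne : sdet (four ψ b) ≠ 0 := sdet_ne_zero hF (four_injective hψ hs hn)
  have c1 : Commute (four ψ b * M') par := hF.mul_left hM'
  have c2 : Commute (par * (four ψ b * M')) par := (Commute.refl _).mul_left c1
  have c3 : Commute (M * four ψ b) par := hM.mul_left hF
  have h3 := congrArg sdet e
  rw [sdet_mul c3, sdet_mul hF, sM, one_mul] at h3
  have hg : gam ψ (-b) ≠ 0 := by
    intro h
    rw [h, zero_smul, sdet_zero] at h3
    exact mul_ne_zero hne hne h3
  rw [sdet_smul F hg (hM'.mul_left c2), sdet_mul c2, sdet_mul c1, sdet_mul hM', sM', one_mul,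
    mul_one, ← mul_assoc] at h3
  exact mul_right_cancel₀ hne h3

theorem sdet_four [Fintype Y] (hψ : ψ ≠ 1) {b : Y →ₗ[F] Y →ₗ[F] F}
    (hs : ∀ z w, b z w = b w z) (hn : ∀ z, (∀ w, b z w = 0) → z = 0) :
    sdet (four ψ b) = gam ψ b := by
  have h := sdet_four_aux hψ (b := -b) (fun z w => by simp [hs z w])
    (fun z hz => hn z fun w => by simpa using hz w)
  have e : - -b = b := by ext; simp
  rw [e, four_neg, sdet_mul (four_commute ψ b), mul_comm] at h
  exact mul_right_cancel₀ sdet_par h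

theorem gam_ne_zero [Fintype Y] (hψ : ψ ≠ 1) {b : Y →ₗ[F] Y →ₗ[F] F}
    (hs : ∀ z w, b z w = b w z) (hn : ∀ z, (∀ w, b z w = 0) → z = 0) : gam ψ b ≠ 0 := by
  rw [← sdet_four hψ hs hn]
  exact sdet_ne_zero (four_commute ψ b) (four_injective hψ hs hn)

/-- The Legendre symbol: `1` on the squares and `-1` elsewhere. -/
def legendre (a : F) : ℂ := by classical exact if IsSquare a then 1 else -1

/-- One-dimensional Gauss sums. -/
theorem gauss_one [Fintype F] (hψ : ψ ≠ 1) {a : F} (ha : a ≠ 0) :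
    ∑ y : F, ψ (-(2⁻¹ * (a * y * y))) = legendre a * ∑ y : F, ψ (-(2⁻¹ * (y * y))) := by
  classical
  have hF : ringChar F ≠ 2 := by
    intro h
    have : ((2 : ℕ) : F) = 0 := by rw [← h]; exact ringChar.Nat.cast_ringChar
    exact NeZero.ne (2 : F) (by exact_mod_cast this)
  rw [legendre]
  split_ifs with h
  · obtain ⟨r, rfl⟩ := h
    have hr : r ≠ 0 := by rintro rfl; simp at ha
    rw [one_mul]
    refine Fintype.sum_equiv (Equiv.mulLeft₀ r hr) _ _ fun y => ?_
    congr 1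
    simp only [Equiv.mulLeft₀_apply]
    ring
  · rw [neg_one_mul, eq_neg_iff_add_eq_zero]
    have hc : ∀ g : F → ℂ, ∑ y : F, g (y * y) = ∑ x : F, ((quadraticChar F x : ℤ) + 1 : ℂ) * g x := by
      intro g
      rw [← Finset.sum_fiberwise (s := Finset.univ) (g := fun y : F => y * y)]
      refine Finset.sum_congr rfl fun x _ => ?_
      have h1 := quadraticChar_card_sqrts hF x
      rw [Finset.sum_congr rfl (g := fun _ => g x)
        (fun y hy => by rw [(Finset.mem_filter.1 hy).2]), Finset.sum_const, nsmul_eq_mul]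
      congr 1
      have h2 : {y : F | y ^ 2 = x}.toFinset = Finset.univ.filter fun y : F => y * y = x := by
        ext y; simp [sq]
      rw [h2] at h1
      exact_mod_cast h1
    have ha' : quadraticChar F a = -1 := by
      rcases quadraticChar_dichotomy ha with h1 | h1
      · exact absurd ((quadraticChar_one_iff_isSquare ha).1 h1) h
      · exact h1
    have e1 := hc fun x => ψ (-(2⁻¹ * (a * x)))
    have e2 := hc fun x => ψ (-(2⁻¹ * x))
    have e3 : ∑ x : F, ((quadraticChar F x : ℤ) + 1 : ℂ) * ψ (-(2⁻¹ * (a * x)))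
        = ∑ x : F, (-(quadraticChar F x : ℤ) + 1 : ℂ) * ψ (-(2⁻¹ * x)) := by
      refine Fintype.sum_equiv (Equiv.mulLeft₀ a ha) _ _ fun x => ?_
      simp only [Equiv.mulLeft₀_apply, map_mul, ha']
      push_cast
      ring
    simp only [mul_assoc]
    rw [e1, e2, e3, ← Finset.sum_add_distrib]
    have h4 : ∑ x : F, ψ (-(2⁻¹ * x)) = 0 := by
      have h2 : (2 : F) ≠ 0 := NeZero.ne 2
      have := sum_char ψ hψ (l := LinearMap.mulLeft F (-(2⁻¹ : F))) (fun h => by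
        have := LinearMap.congr_fun h 1
        simp [h2] at this)
      simpa using this
    have h5 : ∑ x : F, ((-(quadraticChar F x : ℤ) + 1 : ℂ) * ψ (-(2⁻¹ * x))
        + ((quadraticChar F x : ℤ) + 1 : ℂ) * ψ (-(2⁻¹ * x))) = 2 * ∑ x : F, ψ (-(2⁻¹ * x)) := by
      rw [Finset.mul_sum]
      exact Finset.sum_congr rfl fun _ _ => by ring
    rw [h5, h4, mul_zero]

theorem legendre_mul [Finite F] {a b : F} (ha : a ≠ 0) (hb : b ≠ 0) :
    legendre (a * b) = legendre a * legendre b := by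
  classical
  cases nonempty_fintype F
  have hl : ∀ a : F, a ≠ 0 → legendre a = (quadraticChar F a : ℤ) := by
    intro a ha
    rw [legendre]
    split_ifs with h
    · rw [(quadraticChar_one_iff_isSquare ha).2 h]; simp
    · rcases quadraticChar_dichotomy ha with h1 | h1
      · exact absurd ((quadraticChar_one_iff_isSquare ha).1 h1) h
      · rw [h1]; simp
  rw [hl _ ha, hl _ hb, hl _ (mul_ne_zero ha hb), map_mul]
  simp

/-- The matrix form of the permutation operators. -/
def pm {n : ℕ} (M : Matrix (Fin n) (Fin n) F) : Module.End ℂ ((Fin n → F) → ℂ) :=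
  pull (Matrix.toLin' M)

theorem pm_mul {n : ℕ} (M N : Matrix (Fin n) (Fin n) F) : pm (M * N) = pm N * pm M := by
  refine LinearMap.ext fun f => funext fun z => ?_
  simp [pm, pull_apply]

theorem pm_one {n : ℕ} : pm (1 : Matrix (Fin n) (Fin n) F) = 1 := by
  refine LinearMap.ext fun f => funext fun z => ?_
  simp [pm, pull_apply]

theorem sdet_pm_mul {n : ℕ} (M N : Matrix (Fin n) (Fin n) F) :
    sdet (pm (M * N)) = sdet (pm M) * sdet (pm N) := by
  rw [pm_mul, sdet_mul (R' := pm M) (commute_par_pull _), mul_comm]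

/-- Diagonal forms. -/
def diagForm {n : ℕ} (d : Fin n → F) : (Fin n → F) →ₗ[F] (Fin n → F) →ₗ[F] F :=
  Matrix.toLinearMap₂' F (Matrix.diagonal d)

theorem diagForm_apply {n : ℕ} (d : Fin n → F) (z w : Fin n → F) :
    diagForm d z w = ∑ i, d i * z i * w i := by
  rw [diagForm, Matrix.toLinearMap₂'_apply']
  simp only [dotProduct, Matrix.mulVec_diagonal]
  exact Finset.sum_congr rfl fun i _ => by ring

theorem char_sum {ι : Type*} (s : Finset ι) (g : ι → F) : ψ (∑ i ∈ s, g i) = ∏ i ∈ s, ψ (g i) := by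
  classical
  induction s using Finset.induction_on with
  | empty => simp
  | insert i s hi ih => rw [Finset.sum_insert hi, Finset.prod_insert hi, AddChar.map_add_eq_mul, ih]

theorem gam_diagForm [Fintype F] (hψ : ψ ≠ 1) {n : ℕ} {d : Fin n → F} (hd : ∀ i, d i ≠ 0) :
    gam ψ (diagForm d) = (∏ i, legendre (d i)) * gam ψ (diagForm (fun _ : Fin n => (1 : F))) := by
  classical
  have h : ∀ e : Fin n → F, gam ψ (diagForm e) = ∏ i, ∑ y : F, ψ (-(2⁻¹ * (e i * y * y))) := by
    intro e
    rw [Finset.prod_univ_sum, Fintype.piFinset_univ, gam]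
    refine Finset.sum_congr rfl fun z _ => ?_
    rw [diagForm_apply, Finset.mul_sum, ← Finset.sum_neg_distrib, char_sum]
  rw [h, h, ← Finset.prod_mul_distrib]
  refine Finset.prod_congr rfl fun i _ => ?_
  rw [gauss_one hψ (hd i)]
  simp

theorem diagForm_symm {n : ℕ} (d : Fin n → F) (z w : Fin n → F) :
    diagForm d z w = diagForm d w z := by
  rw [diagForm_apply, diagForm_apply]
  exact Finset.sum_congr rfl fun i _ => by ring

theorem diagForm_nondeg {n : ℕ} {d : Fin n → F} (hd : ∀ i, d i ≠ 0) (z : Fin n → F)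
    (h : ∀ w, diagForm d z w = 0) : z = 0 := by
  classical
  ext i
  have := h (Pi.single i 1)
  rw [diagForm_apply] at this
  simpa [Pi.single_apply, hd] using this

theorem sdet_pm_diagonal [Fintype F] (hψ : ψ ≠ 1) {n : ℕ} {d : Fin n → F} (hd : ∀ i, d i ≠ 0) :
    sdet (pm (Matrix.diagonal d)) = ∏ i, legendre (d i) := by
  have h1 : ∀ i : Fin n, (fun _ : Fin n => (1 : F)) i ≠ 0 := fun _ => one_ne_zero
  have e : four ψ (diagForm d) = pm (Matrix.diagonal d) * four ψ (diagForm fun _ => 1) := by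
    refine LinearMap.ext fun f => funext fun z => ?_
    simp only [Module.End.mul_apply, pm, pull_apply, four_apply]
    refine Finset.sum_congr rfl fun w _ => ?_
    congr 2
    rw [diagForm_apply, diagForm_apply]
    refine Finset.sum_congr rfl fun i _ => ?_
    simp [Matrix.mulVec_diagonal]
    ring
  have h := congrArg sdet e
  rw [sdet_mul (four_commute ψ _), sdet_four hψ (diagForm_symm d) (diagForm_nondeg hd),
    sdet_four hψ (diagForm_symm _) (diagForm_nondeg h1), gam_diagForm hψ hd] at h
  exact (mul_right_cancel₀ (gam_ne_zero hψ (diagForm_symm _) (diagForm_nondeg h1)) h).symm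

theorem legendre_mul_self (a : F) : legendre a * legendre a = 1 := by
  rw [legendre]; split_ifs <;> simp

theorem legendre_one : legendre (1 : F) = 1 := by
  rw [legendre, if_pos ⟨1, by simp⟩]

theorem legendre_prod [Finite F] {n : ℕ} {d : Fin n → F} (hd : ∀ i, d i ≠ 0) :
    legendre (∏ i, d i) = ∏ i, legendre (d i) := by
  have : ∀ s : Finset (Fin n), legendre (∏ i ∈ s, d i) = ∏ i ∈ s, legendre (d i) := by
    classical
    intro s
    induction s using Finset.induction_on with
    | empty => simp [legendre_one]
    | insert i s hi ih =>
      rw [Finset.prod_insert hi, Finset.prod_insert hi, legendre_mul (hd i)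
        (Finset.prod_ne_zero_iff.2 fun j _ => hd j), ih]
  exact this _

theorem sdet_pm [Fintype F] (hψ : ψ ≠ 1) {n : ℕ} (M : Matrix (Fin n) (Fin n) F) (hM : M.det ≠ 0) :
    sdet (pm M) = legendre M.det := by
  classical
  refine Matrix.diagonal_transvection_induction_of_det_ne_zero
    (fun M => sdet (pm M) = legendre M.det) M hM ?_ ?_ ?_
  · intro d hd
    rw [Matrix.det_diagonal] at hd ⊢
    have hd' : ∀ i, d i ≠ 0 := fun i => (Finset.prod_ne_zero_iff.1 hd) i (Finset.mem_univ i)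
    rw [sdet_pm_diagonal hψ hd', legendre_prod hd']
  · intro t
    have h2 : (2 : F) ≠ 0 := NeZero.ne 2
    rw [Matrix.TransvectionStruct.det, legendre_one, Matrix.TransvectionStruct.toMatrix]
    obtain ⟨i, j, hij, c⟩ := t
    simp only
    let d : Fin n → F := fun k => if k = i then -1 else 1
    have hd : ∀ k, d k ≠ 0 := fun k => by simp only [d]; split_ifs <;> simp
    let D := Matrix.diagonal d
    let T := Matrix.transvection i j (c / 2)
    have hT : T * T = Matrix.transvection i j c := by
      rw [Matrix.transvection_mul_transvection_same _ _ hij]; simp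
    have hD : D * D = 1 := by
      rw [Matrix.diagonal_mul_diagonal, ← Matrix.diagonal_one]
      congr 1
      ext k
      simp only [d]; split_ifs <;> simp
    have hDT : D * T * D * T = 1 := by
      have : D * T * D = Matrix.transvection i j (-(c / 2)) := by
        simp only [T, Matrix.transvection, mul_add, add_mul, mul_one, hD]
        congr 1
        ext k l
        simp only [D, Matrix.mul_diagonal, Matrix.diagonal_mul, Matrix.single_apply, d]
        by_cases h : i = k ∧ j = l
        · obtain ⟨rfl, rfl⟩ := h
          simp [hij.symm]
        · simp [h]
      rw [this, Matrix.transvection_mul_transvection_same _ _ hij]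
      simp
    have s1 : sdet (pm D) * sdet (pm D) = 1 := by
      rw [← sdet_pm_mul, hD, pm_one, sdet_one]
    have s2 := congrArg (fun A => sdet (pm A)) hDT
    simp only [sdet_pm_mul, pm_one, sdet_one] at s2
    rw [← hT, sdet_pm_mul]
    linear_combination s2 - sdet (pm T) * sdet (pm T) * s1
  · intro A C hA hC h1 h2
    rw [sdet_pm_mul, h1, h2, Matrix.det_mul, legendre_mul hA hC]

theorem sdet_conj {Y' : Type*} [AddCommGroup Y'] [Module F Y'] (e : Y ≃ₗ[F] Y') (D : Y → Y) :
    sdet (pull D) = sdet (pull (fun y' => e (D (e.symm y')))) := by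
  let E : (Y → ℂ) ≃ₗ[ℂ] (Y' → ℂ) := LinearEquiv.funCongrLeft ℂ ℂ e.symm.toEquiv
  have hE : ∀ f z, E f z = f (e.symm z) := fun _ _ => rfl
  have hE' : ∀ f z, E.symm f z = f (e z) := fun _ _ => rfl
  rw [sdet, sdet, ← LinearMap.det_conj _ E, ← LinearMap.det_conj (evenP + pull D * oddP) E]
  congr 2
  · refine LinearMap.ext fun f => funext fun z => ?_
    simp [hE, hE', pull_apply, evenP_apply, oddP_apply]
  · refine LinearMap.ext fun f => funext fun z => ?_
    simp [hE, hE', pull_apply, evenP_apply, oddP_apply]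

theorem sdet_pull [Finite F] (hψ : ψ ≠ 1) [Module.Finite F Y] (D : Y ≃ₗ[F] Y) :
    sdet (pull D) = legendre (LinearMap.det (D : Y →ₗ[F] Y)) := by
  classical
  cases nonempty_fintype F
  let b := Module.finBasis F Y
  have h1 := LinearMap.det_toMatrix b (D : Y →ₗ[F] Y)
  rw [← h1, ← sdet_pm hψ _ (by rw [h1]; exact D.isUnit_det'.ne_zero), sdet_conj b.equivFun]
  congr 1
  refine LinearMap.ext fun f => funext fun z => ?_
  simp only [pm, pull_apply]
  congr 1
  rw [← LinearMap.toMatrix'_toLin' (LinearMap.toMatrix b b (D : Y →ₗ[F] Y))]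
  have := LinearMap.toMatrix_mulVec_repr b b (D : Y →ₗ[F] Y) (b.equivFun.symm z)
  simp only [Matrix.toLin'_apply, LinearMap.toMatrix'_toLin']
  ext i
  have h3 := congrFun this i
  have h4 : (⇑(b.repr (b.equivFun.symm z)) : _ → F) = z := by
    rw [← Module.Basis.equivFun_apply, LinearEquiv.apply_symm_apply]
  rw [h4] at h3
  rw [h3]
  rfl

end Fourier

section Oscillator

variable {F X Y : Type*} [Field F] [AddCommGroup X] [Module F X] [AddCommGroup Y] [Module F Y]
  [NeZero (2 : F)]

/-- The delta function at `z`. -/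
def delta (z : Y) : Y → ℂ := by classical exact Pi.single z 1

/-- The Gauss sum `γ(A)`, the sum over all `y` of `ψ(-⟨A y, y⟩ / 2)`. -/
def gaussSumOf (B : X →ₗ[F] Y →ₗ[F] F) (ψ : AddChar F ℂ) (A : Y →ₗ[F] X) : ℂ :=
  ∑ᶠ y : Y, ψ (-(2⁻¹ * B (A y) y))

/-- `μ` is the oscillator representation on the functions on `Y`, for the additive character `ψ`:
it is given by the standard formulas on the block matrices
`(1, A; 0, 1)` with `A : Y → X` symmetric, `(0, A; -A⁻¹, 0)` with `A : Y → X` symmetric and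
invertible, and `(C, 0; 0, D)` with `C : X → X` invertible (here `D` has to be the inverse of the
adjoint of `C`). As these elements generate the symplectic group, they determine `μ`. -/
structure IsOscillator (B : X →ₗ[F] Y →ₗ[F] F) (ψ : AddChar F ℂ)
    (μ : Representation ℂ (SpGroup B) (Y → ℂ)) : Prop where
  unipotent : ∀ (S : SpGroup B) (A : Y →ₗ[F] X), (∀ y y', B (A y) y' = B (A y') y) →
    (∀ x y, S.1 (x, y) = (x + A y, y)) →
    ∀ y, μ S (delta y) = ψ (2⁻¹ * B (A y) y) • delta y
  fourier : ∀ (S : SpGroup B) (A : Y ≃ₗ[F] X), (∀ y y', B (A y) y' = B (A y') y) →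
    (∀ x y, S.1 (x, y) = (A y, -A.symm x)) →
    ∀ y, μ S (delta y)
      = (gaussSumOf B ψ (A : Y →ₗ[F] X))⁻¹ • ∑ᶠ y' : Y, ψ (B (A y) y') • delta y'
  levi : ∀ (S : SpGroup B) (C : X ≃ₗ[F] X) (D : Y ≃ₗ[F] Y),
    (∀ x y, S.1 (x, y) = (C x, D y)) →
    ∀ y, μ S (delta y) = legendre (LinearMap.det (C : X →ₗ[F] X)) • delta (D y)

theorem delta_apply [DecidableEq Y] (z w : Y) : delta z w = if w = z then 1 else 0 := by
  by_cases h : w = z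
  · subst h; simp [delta]
  · simp [delta, h]

theorem det_adjoint {B : X →ₗ[F] Y →ₗ[F] F} (hB : B.Nondegenerate) [Module.Finite F X]
    [Module.Finite F Y] (C : X ≃ₗ[F] X) (D : Y ≃ₗ[F] Y) (h : ∀ x y, B (C x) (D y) = B x y) :
    LinearMap.det (D.symm : Y →ₗ[F] Y) = LinearMap.det (C : X →ₗ[F] X) := by
  have hi : Function.Injective B := (injective_iff_map_eq_zero B).2 fun x hx =>
    hB.1 x fun y => by rw [hx]; rfl
  have hi' : Function.Injective B.flip := (injective_iff_map_eq_zero B.flip).2 fun y hy =>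
    hB.2 y fun x => by simpa using LinearMap.congr_fun hy x
  have h1 := LinearMap.finrank_le_finrank_of_injective hi
  have h2 := LinearMap.finrank_le_finrank_of_injective hi'
  rw [Subspace.dual_finrank_eq] at h1 h2
  let E : X ≃ₗ[F] Module.Dual F Y := LinearEquiv.ofInjectiveOfFinrankEq B hi (by
    rw [Subspace.dual_finrank_eq]; omega)
  have hE : ∀ x, E x = B x := fun x => rfl
  rw [← LinearMap.det_dualMap, ← LinearMap.det_conj (C : X →ₗ[F] X) E]
  congr 1
  refine LinearMap.ext fun φ => LinearMap.ext fun y => ?_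
  obtain ⟨x, rfl⟩ := E.surjective φ
  have := h x (D.symm y)
  simp only [LinearEquiv.apply_symm_apply] at this
  rw [LinearMap.comp_apply, LinearMap.comp_apply, LinearMap.dualMap_apply]
  simp only [LinearEquiv.coe_coe, LinearEquiv.symm_apply_apply]
  rw [hE, hE, this]

/-- The oscillator representation exists, and it is compatible with the Weyl representation. -/
theorem exists_oscillator {B : X →ₗ[F] Y →ₗ[F] F} (hB : B.Nondegenerate) {ψ : AddChar F ℂ}
    (hψ : ψ ≠ 1) [Finite F] [Module.Finite F X] [Module.Finite F Y] :
    ∃ μ : Representation ℂ (SpGroup B) (Y → ℂ), IsOscillator B ψ μ ∧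
      ∀ S g, μ S * weyl B ψ g = weyl B ψ (heisAction B S g) * μ S := by
  classical
  have : Finite X := Module.finite_of_finite F
  have : Finite Y := Module.finite_of_finite F
  cases nonempty_fintype X
  cases nonempty_fintype Y
  have hone : oscFun B ψ 1 = 1 := eq_oscFun B ψ hB hψ
    (fun v => by change _ = weylOp B ψ v * 1; simp) (Commute.one_left _) sdet_one
  have hmul : ∀ S S', oscFun B ψ (S * S') = oscFun B ψ S * oscFun B ψ S' := fun S S' =>
    eq_oscFun B ψ hB hψ ((oscFun_intertwines B ψ S).mul (oscFun_intertwines B ψ S'))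
      ((oscFun_commute B ψ S).mul_left (oscFun_commute B ψ S'))
      (by rw [sdet_mul (oscFun_commute B ψ S'), sdet_oscFun B ψ hB hψ, sdet_oscFun B ψ hB hψ,
        mul_one])
  refine ⟨⟨⟨oscFun B ψ, hone⟩, hmul⟩, ⟨?_, ?_, ?_⟩, ?_⟩
  · intro S A hA hS y
    have : oscFun B ψ S = mulBy fun z => ψ (2⁻¹ * B (A z) z) := by
      refine eq_oscFun B ψ hB hψ ?_ (commute_par_mulBy fun y => by simp) ?_
      · rintro ⟨x, y⟩
        rw [hS]
        refine LinearMap.ext fun f => funext fun z => ?_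
        simp only [Module.End.mul_apply, mulBy_apply, weylOp_apply, ← mul_assoc,
          ← AddChar.map_add_eq_mul]
        congr 2
        simp only [map_add, map_sub, LinearMap.add_apply, LinearMap.sub_apply]
        rw [hA y z]
        have h2 : (2 : F) ≠ 0 := NeZero.ne 2
        field_simp
        ring
      · rw [sdet_mulBy F (fun y => by simp) (fun y => (ψ.val_isUnit _).ne_zero)]; simp
    change oscFun B ψ S _ = _
    rw [this]
    ext w
    simp only [mulBy_apply, Pi.smul_apply, smul_eq_mul, delta_apply]
    split_ifs with h
    · rw [h]
    · simp
  · intro S A hA hS y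
    let b : Y →ₗ[F] Y →ₗ[F] F := B.comp (A : Y →ₗ[F] X)
    have hb : ∀ z w, b z w = B (A z) w := fun _ _ => rfl
    have hbs : ∀ z w, b z w = b w z := hA
    have hbn : ∀ z, (∀ w, b z w = 0) → z = 0 := fun z hz => by
      simpa using hB.1 (A z) hz
    have hg : gam ψ b ≠ 0 := gam_ne_zero hψ hbs hbn
    have : oscFun B ψ S = (gam ψ b)⁻¹ • four ψ b := by
      refine eq_oscFun B ψ hB hψ (Intertwines.smul ?_ _) ((four_commute ψ b).smul_left _) ?_
      · rintro ⟨x, y⟩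
        rw [hS]
        refine LinearMap.ext fun f => funext fun z' => ?_
        simp only [Module.End.mul_apply, four_apply, weylOp_apply, Finset.mul_sum]
        refine Fintype.sum_equiv (Equiv.subRight y) _ _ fun z => ?_
        simp only [← mul_assoc, ← AddChar.map_add_eq_mul, Equiv.subRight_apply, hb]
        congr 2
        have e1 : ∀ w, B (A w) (A.symm x) = B x w := fun w => by
          rw [hA, LinearEquiv.apply_symm_apply]
        simp only [sub_neg_eq_add, map_sub, map_add, map_neg, LinearMap.sub_apply, e1]
        have h2 : (2 : F) ≠ 0 := NeZero.ne 2
        field_simp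
        ring
      · rw [sdet_smul F (inv_ne_zero hg) (four_commute ψ b), sdet_four hψ hbs hbn,
          inv_mul_cancel₀ hg]
    change oscFun B ψ S _ = _
    rw [this, gaussSumOf, finsum_eq_sum_of_fintype, finsum_eq_sum_of_fintype,
      LinearMap.smul_apply]
    congr 1
    ext w
    simp [four_apply, delta_apply, hb]
  · intro S C D hS y
    have hCD : ∀ x y, B (C x) (D y) = B x y := fun x y => by
      have := S.2 (x, 0) (0, y)
      rw [hS, hS] at this
      simpa [sympForm] using this
    have hl : legendre (LinearMap.det (D.symm : Y →ₗ[F] Y))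
        = legendre (LinearMap.det (C : X →ₗ[F] X)) := by rw [det_adjoint hB C D hCD]
    have hc : Commute (pull D.symm) (par : Module.End ℂ (Y → ℂ)) :=
      commute_par_pull (F := F) (D.symm : Y →ₗ[F] Y)
    have hl0 : legendre (LinearMap.det (C : X →ₗ[F] X)) ≠ 0 := fun h => by
      have := legendre_mul_self (LinearMap.det (C : X →ₗ[F] X))
      rw [h] at this
      simp at this
    have : oscFun B ψ S = legendre (LinearMap.det (C : X →ₗ[F] X)) • pull D.symm := by
      refine eq_oscFun B ψ hB hψ (Intertwines.smul ?_ _) (hc.smul_left _) ?_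
      · rintro ⟨x, y⟩
        rw [hS]
        refine LinearMap.ext fun f => funext fun z => ?_
        simp only [Module.End.mul_apply, pull_apply, weylOp_apply, hCD, map_sub,
          LinearEquiv.symm_apply_apply]
        congr 3
        rw [← hCD, LinearEquiv.apply_symm_apply]
      · rw [sdet_smul F hl0 hc, sdet_pull hψ, hl, legendre_mul_self]
    change oscFun B ψ S _ = _
    rw [this, LinearMap.smul_apply]
    congr 1
    ext w
    rw [pull_apply, delta_apply, delta_apply]
    simp [LinearEquiv.symm_apply_eq]
  · intro S g
    change oscFun B ψ S * _ = _ * oscFun B ψ S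
    rw [weyl_eq, weyl_eq, mul_smul_comm, oscFun_intertwines B ψ S, smul_mul_assoc]
    rfl

variable [Finite F] [Module.Finite F X] [Module.Finite F Y]

/-- The oscillator representation of the symplectic group of `X ⊕ Y` on the functions on `Y`. -/
def oscillator (B : X →ₗ[F] Y →ₗ[F] F) (hB : B.Nondegenerate) (ψ : AddChar F ℂ) (hψ : ψ ≠ 1) :
    Representation ℂ (SpGroup B) (Y → ℂ) := (exists_oscillator hB hψ).choose

theorem isOscillator_oscillator {B : X →ₗ[F] Y →ₗ[F] F} (hB : B.Nondegenerate)
    {ψ : AddChar F ℂ} (hψ : ψ ≠ 1) : IsOscillator B ψ (oscillator B hB ψ hψ) :=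
  (exists_oscillator hB hψ).choose_spec.1

theorem oscillator_mul_weyl {B : X →ₗ[F] Y →ₗ[F] F} (hB : B.Nondegenerate)
    {ψ : AddChar F ℂ} (hψ : ψ ≠ 1) (S : SpGroup B) (g : Heisenberg B) :
    oscillator B hB ψ hψ S * weyl B ψ g
      = weyl B ψ (heisAction B S g) * oscillator B hB ψ hψ S :=
  (exists_oscillator hB hψ).choose_spec.2 S g

/-- The representation `(c, v, S) ↦ W(c, v) μ(S)` of the Jacobi group on the functions on `Y`. The
operators that realize it form the Clifford group. -/
def clifford (B : X →ₗ[F] Y →ₗ[F] F) (hB : B.Nondegenerate) (ψ : AddChar F ℂ) (hψ : ψ ≠ 1) :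
    Representation ℂ (Jacobi B) (Y → ℂ) where
  toFun g := weyl B ψ g.left * oscillator B hB ψ hψ g.right
  map_one' := by simp
  map_mul' g h := by
    rw [SemidirectProduct.mul_left, SemidirectProduct.mul_right, map_mul, map_mul, mul_assoc,
      mul_assoc, ← mul_assoc (oscillator B hB ψ hψ g.right), oscillator_mul_weyl]
    simp only [mul_assoc]

end Oscillator

section Eval

variable {F : Type*} [Field F] (X : Type*) [AddCommGroup X] [Module F X]

/-- The evaluation pairing of `X` and its dual. With it, `X × Module.Dual F X` is the standard
symplectic space `V = X ⊕ X*`. -/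
abbrev evalPairing : X →ₗ[F] Module.Dual F X →ₗ[F] F := Module.Dual.eval F X

theorem evalPairing_nondegenerate : (evalPairing (F := F) X).Nondegenerate :=
  ⟨fun x hx => (Module.forall_dual_apply_eq_zero_iff F x).1 hx, fun _ hy => LinearMap.ext hy⟩

end Eval

section Tensor

variable {F : Type*} [Field F] (X : Type*) [AddCommGroup X] [Module F X] [FiniteDimensional F X]
  {U : Type*} [AddCommGroup U] [Module F U]

/-- The pairing `⟨u ⊗ x, G⟩ = β(u, G x)` of `U ⊗ X` and `Hom(X, U) = U ⊗ X*`, for a bilinear form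
`β` on `U`. With it, `(U ⊗ X) × Hom(X, U)` is the space `U ⊗ V`, where `V = X ⊕ X*`. -/
def tensorPairing (β : LinearMap.BilinForm F U) : U ⊗[F] X →ₗ[F] (X →ₗ[F] U) →ₗ[F] F :=
  TensorProduct.lift (LinearMap.mk₂ F (fun u x => (β u).comp (LinearMap.applyₗ x))
    (fun _ _ _ => by ext; simp) (fun _ _ _ => by ext; simp) (fun _ _ _ => by ext; simp)
    (fun _ _ _ => by ext; simp))

theorem tensorPairing_tmul (β : LinearMap.BilinForm F U) (u : U) (x : X) (G : X →ₗ[F] U) :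
    tensorPairing X β (u ⊗ₜ x) G = β u (G x) := by simp [tensorPairing]

theorem tensorPairing_nondegenerate {β : LinearMap.BilinForm F U} (hβ : β.Nondegenerate) :
    (tensorPairing X β).Nondegenerate := by
  refine ⟨fun z hz => ?_, fun G hG => LinearMap.ext fun x => hβ.2 _ fun u => ?_⟩
  · let b := Module.finBasis F X
    obtain ⟨c, rfl⟩ := TensorProduct.eq_repr_basis_right b z
    have : c = 0 := by
      ext i
      refine hβ.1 _ fun v => ?_
      have := hz ((b.coord i).smulRight v)
      rw [Finsupp.sum, map_sum, LinearMap.sum_apply] at this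
      simp only [tensorPairing_tmul, LinearMap.smulRight_apply, Module.Basis.coord_apply,
        Module.Basis.repr_self] at this
      classical
      rw [Finset.sum_eq_single i] at this
      · simpa using this
      · intro j _ hj
        simp [hj]
      · intro hi
        simp [Finsupp.notMem_support_iff.1 hi]
    simp [this]
  · simpa [tensorPairing_tmul] using hG (u ⊗ₜ x)

/-- The identification of `U ⊗ (X ⊕ X*)` with `(U ⊗ X) ⊕ Hom(X, U)`, which maps `u ⊗ (x ⊕ y)` to
`(u ⊗ x) ⊕ (x' ↦ y(x') u)`. -/
def tensorV : U ⊗[F] (X × Module.Dual F X) ≃ₗ[F] (U ⊗[F] X) × (X →ₗ[F] U) :=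
  (TensorProduct.prodRight F F U X (Module.Dual F X)).trans
    (LinearEquiv.prodCongr (LinearEquiv.refl F (U ⊗[F] X))
      ((TensorProduct.comm F U (Module.Dual F X)).trans (dualTensorHomEquiv F X U)))

theorem tensorV_tmul (u : U) (v : X × Module.Dual F X) :
    tensorV X (u ⊗ₜ v) = (u ⊗ₜ v.1, v.2.smulRight u) := by
  refine Prod.ext ?_ ?_
  · simp [tensorV]
  · ext x
    simp [tensorV]

variable {X}

theorem sympForm_tensorV {β : LinearMap.BilinForm F U} (hs : β.IsSymm) (u u' : U)
    (v v' : X × Module.Dual F X) :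
    sympForm (tensorPairing X β) (tensorV X (u ⊗ₜ v)) (tensorV X (u' ⊗ₜ v'))
      = β u u' * sympForm (evalPairing X) v v' := by
  rw [tensorV_tmul, tensorV_tmul, sympForm, sympForm, tensorPairing_tmul, tensorPairing_tmul]
  simp [hs.eq u' u]
  ring

theorem sympForm_lTensor {β : LinearMap.BilinForm F U} (hs : β.IsSymm)
    (S : SpGroup (evalPairing (F := F) X)) (z z' : U ⊗[F] (X × Module.Dual F X)) :
    sympForm (tensorPairing X β) (tensorV X (LinearEquiv.lTensor U S.1 z))
        (tensorV X (LinearEquiv.lTensor U S.1 z'))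
      = sympForm (tensorPairing X β) (tensorV X z) (tensorV X z') := by
  have add_l : ∀ a b c : (U ⊗[F] X) × (X →ₗ[F] U), sympForm (tensorPairing X β) (a + b) c
      = sympForm (tensorPairing X β) a c + sympForm (tensorPairing X β) b c := fun a b c => by
    simp [sympForm]; ring
  have add_r : ∀ a b c : (U ⊗[F] X) × (X →ₗ[F] U), sympForm (tensorPairing X β) c (a + b)
      = sympForm (tensorPairing X β) c a + sympForm (tensorPairing X β) c b := fun a b c => by
    simp [sympForm]; ring
  induction z using TensorProduct.induction_on with
  | zero => simp [sympForm]
  | add a b ha hb => rw [map_add, map_add, map_add, add_l, add_l, ha, hb]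
  | tmul u v =>
    induction z' using TensorProduct.induction_on with
    | zero => simp [sympForm]
    | add a b ha hb => rw [map_add, map_add, map_add, add_r, add_r, ha, hb]
    | tmul u' v' =>
      rw [LinearEquiv.lTensor_tmul, LinearEquiv.lTensor_tmul, sympForm_tensorV hs,
        sympForm_tensorV hs, S.2 v v']

theorem lTensor_one' {W : Type*} [AddCommGroup W] [Module F W] (z : U ⊗[F] W) :
    LinearEquiv.lTensor U (1 : W ≃ₗ[F] W) z = z := by
  induction z using TensorProduct.induction_on with
  | zero => simp
  | add a b ha hb => rw [map_add, ha, hb]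
  | tmul u v => rw [LinearEquiv.lTensor_tmul]; rfl

theorem lTensor_mul' {W : Type*} [AddCommGroup W] [Module F W] (S T : W ≃ₗ[F] W) (z : U ⊗[F] W) :
    LinearEquiv.lTensor U (S * T) z = LinearEquiv.lTensor U S (LinearEquiv.lTensor U T z) := by
  induction z using TensorProduct.induction_on with
  | zero => simp
  | add a b ha hb => rw [map_add, ha, hb, map_add, map_add]
  | tmul u v => rw [LinearEquiv.lTensor_tmul, LinearEquiv.lTensor_tmul, LinearEquiv.lTensor_tmul]; rfl

/-- The embedding `S ↦ 1 ⊗ S` of `Sp(V)` into `Sp(U ⊗ V)`. -/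
def spEmbed {β : LinearMap.BilinForm F U} (hs : β.IsSymm) :
    SpGroup (evalPairing (F := F) X) →* SpGroup (tensorPairing X β) where
  toFun S := ⟨((tensorV X).symm.trans (LinearEquiv.lTensor U S.1)).trans (tensorV X), fun a b => by
    simpa using sympForm_lTensor hs S ((tensorV X).symm a) ((tensorV X).symm b)⟩
  map_one' := by
    refine Subtype.ext (LinearEquiv.ext fun a => ?_)
    change tensorV X (LinearEquiv.lTensor U (1 : (X × Module.Dual F X) ≃ₗ[F] _)
      ((tensorV X).symm a)) = a
    rw [lTensor_one', LinearEquiv.apply_symm_apply]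
  map_mul' S T := by
    refine Subtype.ext (LinearEquiv.ext fun a => ?_)
    change tensorV X (LinearEquiv.lTensor U (S.1 * T.1) ((tensorV X).symm a))
      = tensorV X (LinearEquiv.lTensor U S.1 ((tensorV X).symm
          (tensorV X (LinearEquiv.lTensor U T.1 ((tensorV X).symm a)))))
    rw [LinearEquiv.symm_apply_apply, lTensor_mul']

theorem spEmbed_tmul {β : LinearMap.BilinForm F U} (hs : β.IsSymm)
    (S : SpGroup (evalPairing (F := F) X)) (u : U) (v : X × Module.Dual F X) :
    (spEmbed hs S).1 (tensorV X (u ⊗ₜ v)) = tensorV X (u ⊗ₜ S.1 v) := by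
  change tensorV X (LinearEquiv.lTensor U S.1 ((tensorV X).symm (tensorV X (u ⊗ₜ v)))) = _
  rw [LinearEquiv.symm_apply_apply, LinearEquiv.lTensor_tmul]

/-- The homomorphism `ι_u : (c, v) ↦ (β(u, u) c, u ⊗ v)` of the Heisenberg groups over `V` and over
`U ⊗ V`. -/
def heisEmbed {β : LinearMap.BilinForm F U} (hs : β.IsSymm) (u : U) :
    Heisenberg (evalPairing (F := F) X) →* Heisenberg (tensorPairing X β) where
  toFun g := ⟨β u u * g.c, tensorV X (u ⊗ₜ g.v)⟩
  map_one' := by simp [heis_one]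
  map_mul' g h := by
    rw [heis_mul, heis_mul]
    simp only [sympForm_tensorV hs, TensorProduct.tmul_add, map_add]
    congr 1
    ring

/-- The homomorphism of the Jacobi groups over `V` and over `U ⊗ V` that `ι_u` and `S ↦ 1 ⊗ S`
induce. -/
def jacobiEmbed {β : LinearMap.BilinForm F U} (hs : β.IsSymm) (u : U) :
    Jacobi (evalPairing (F := F) X) →* Jacobi (tensorPairing X β) :=
  SemidirectProduct.map (heisEmbed hs u) (spEmbed hs) fun S => by
    refine MonoidHom.ext fun g => ?_
    change (⟨_, tensorV X (u ⊗ₜ S.1 g.v)⟩ : Heisenberg (tensorPairing X β))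
      = ⟨_, (spEmbed hs S).1 (tensorV X (u ⊗ₜ g.v))⟩
    rw [spEmbed_tmul]
    rfl

/-- The orthogonal complement of a vector. -/
abbrev perp (β : LinearMap.BilinForm F U) (u : U) : Submodule F U :=
  β.orthogonal (Submodule.span F {u})

theorem perp_isSymm {β : LinearMap.BilinForm F U} (hs : β.IsSymm) (u : U) :
    (β.restrict (perp β u)).IsSymm := ⟨fun x y => hs.eq x y⟩

theorem perp_nondegenerate {β : LinearMap.BilinForm F U} (hs : β.IsSymm) (hn : β.Nondegenerate)
    {u : U} (hu : β u u ≠ 0) : (β.restrict (perp β u)).Nondegenerate :=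
  LinearMap.BilinForm.restrict_nondegenerate_orthogonal_spanSingleton β hn hs.isRefl hu

variable (X)

/-- For a space `K` of functions on `Hom(X, u^⊥)`, the space `L²(X*) ⊗ K`, realized as the span of
the functions `u ⊗ y + G ↦ φ(y) k(G)` on `Hom(X, U)`, where `φ` is a function on `X*` and `k ∈ K`.
Here `y` runs through `X*` and `G` through `Hom(X, u^⊥)`. -/
def tensorWith (β : LinearMap.BilinForm F U) (u : U)
    (K : Submodule ℂ ((X →ₗ[F] perp β u) → ℂ)) : Submodule ℂ ((X →ₗ[F] U) → ℂ) :=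
  Submodule.span ℂ {f | ∃ φ : Module.Dual F X → ℂ, ∃ k ∈ K,
    ∀ (y : Module.Dual F X) (G : X →ₗ[F] perp β u),
      f (y.smulRight u + (perp β u).subtype.comp G) = φ y * k G}

end Tensor

section Concrete

variable (p : ℕ) [Fact p.Prime] {F : Type*} [Field F] [Finite F] [NeZero (2 : F)]
  [Algebra (ZMod p) F]

/-- The character `ω^{(m)}(a) = exp(2πi Tr(m a) / p)` of `F`. -/
def omega (m : Fˣ) : AddChar F ℂ :=
  (ZMod.stdAddChar (N := p)).compAddMonoidHom
    ((Algebra.trace (ZMod p) F).toAddMonoidHom.comp (AddMonoidHom.mulLeft (m : F)))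

theorem omega_apply (m : Fˣ) (a : F) :
    omega p m a = ZMod.stdAddChar (Algebra.trace (ZMod p) F (m * a)) := rfl

theorem omega_ne_one (m : Fˣ) : omega p m ≠ 1 := by
  intro h
  have : Module.Finite (ZMod p) F := Module.Finite.of_finite
  obtain ⟨a, ha⟩ : ∃ a, Algebra.trace (ZMod p) F a ≠ 0 := by
    by_contra! h'
    exact Algebra.trace_ne_zero (ZMod p) F (LinearMap.ext h')
  have h1 := DFunLike.congr_fun h ((m⁻¹ : Fˣ) * a)
  rw [omega_apply, Units.mul_inv_cancel_left, AddChar.one_apply] at h1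
  exact ha (ZMod.injective_stdAddChar (h1.trans (AddChar.map_zero_eq_one _).symm))

/-- A natural number that `p` does not divide, as a unit of `F`. -/
def unitOfNat (t : ℕ) (ht : ¬ p ∣ t) : Fˣ := Units.mk0 (t : F) (by
  have : CharP F p := charP_of_injective_algebraMap (algebraMap (ZMod p) F).injective p
  rwa [Ne, CharP.cast_eq_zero_iff F p])

variable (X : Type*) [AddCommGroup X] [Module F X] [FiniteDimensional F X]

/-- The oscillator representation `μ_V^{(m)}` of `Sp(V)`, where `V = X ⊕ X*`, on the functions on
`X*`. -/
def muV (m : Fˣ) : Representation ℂ (SpGroup (evalPairing (F := F) X)) (Module.Dual F X → ℂ) :=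
  oscillator (evalPairing (F := F) X) (evalPairing_nondegenerate X) (omega p m) (omega_ne_one p m)

/-- The Clifford representation `Cl_V^{(m)}` of the Jacobi group over `V = X ⊕ X*`. -/
def clV (m : Fˣ) : Representation ℂ (Jacobi (evalPairing (F := F) X)) (Module.Dual F X → ℂ) :=
  clifford (evalPairing (F := F) X) (evalPairing_nondegenerate X) (omega p m) (omega_ne_one p m)

variable {U : Type*} [AddCommGroup U] [Module F U] [FiniteDimensional F U]

/-- The oscillator representation `μ_{U ⊗ V}` (of mass one) on the functions on `Hom(X, U)`,
restricted to `Sp(V)`. -/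
def muU {β : LinearMap.BilinForm F U} (hs : β.IsSymm) (hn : β.Nondegenerate) :
    Representation ℂ (SpGroup (evalPairing (F := F) X)) ((X →ₗ[F] U) → ℂ) :=
  (oscillator (tensorPairing X β) (tensorPairing_nondegenerate X hn) (omega p 1)
    (omega_ne_one p 1)).comp (spEmbed hs)

/-- The representation `Cl^{(u)}_{U ⊗ V} : (c, v, S) ↦ W_{U ⊗ V}(ι_u(c, v)) μ_{U ⊗ V}(S)` of the
Jacobi group over `V` on the functions on `Hom(X, U)`. -/
def clU {β : LinearMap.BilinForm F U} (hs : β.IsSymm) (hn : β.Nondegenerate) (u : U) :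
    Representation ℂ (Jacobi (evalPairing (F := F) X)) ((X →ₗ[F] U) → ℂ) :=
  (clifford (tensorPairing X β) (tensorPairing_nondegenerate X hn) (omega p 1)
    (omega_ne_one p 1)).comp (jacobiEmbed hs u)

theorem clU_apply {β : LinearMap.BilinForm F U} (hs : β.IsSymm) (hn : β.Nondegenerate) (u : U)
    (g : Jacobi (evalPairing (F := F) X)) :
    clU p X hs hn u g = weyl (tensorPairing X β) (omega p 1) (heisEmbed hs u g.left)
      * muU p X hs hn g.right := rfl

end Concrete

/-- The `n`-th tensor power of a representation. -/
def tensorPow {G W : Type*} [Group G] [AddCommGroup W] [Module ℂ W] (ρ : Representation ℂ G W)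
    (n : ℕ) : Representation ℂ G (⨂[ℂ] _ : Fin n, W) :=
  PiTensorProduct.mapMonoidHom.comp (MonoidHom.pi fun _ => ρ)

/-- A subrepresentation is irreducible if, as a representation, it is nonzero and has no proper
nonzero subrepresentations. This is the content of `Representation.IsIrreducible`, which asks for an
instance of `AddCommGroup`. -/
def IsIrreducibleSub {G W : Type*} [Group G] [AddCommMonoid W] [Module ℂ W]
    {ρ : Representation ℂ G W} (K : Subrepresentation ρ) : Prop :=
  IsSimpleOrder (Subrepresentation K.toRepresentation)

end

end OscillatorRep

namespace OscillatorRep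

open scoped TensorProduct

set_option linter.unusedSectionVars false

noncomputable section

/-! ### Lattices of invariant subspaces and tensor products -/

section Lattice

variable {G H W M E : Type*} [Group G] [Group H] [AddCommGroup W] [Module ℂ W]
  [AddCommGroup M] [Module ℂ M] [AddCommGroup E] [Module ℂ E]

/-! Let b = β(u, u). Splitting U into the line through u and U' = u^⊥ turns L²(Hom(X, U)) into
L²(X*) ⊗ L²(Hom(X, U')). A Weyl operator at u ⊗ v acts on the first factor alone, as the Weyl
operator of mass b at v (`weylOp_split_left`). These operators span End L²(X*) (`span_weylOp`), so
an invariant subspace is stable under End L²(X*) ⊗ 1 and therefore equals L²(X*) ⊗ K for a unique K.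

It remains to see which K occur. The operators μ_{U ⊗ V}(S) and μ_V^{(b)}(S) ⊗ μ_{U' ⊗ V}(S)
intertwine the Weyl operators in the same way, so by Schur's lemma they agree up to a nonzero scalar
(`muU_split`). Invariance of subspaces does not depend on scalars, and the first factor is already
filled, so the condition is that K be invariant under μ_{U' ⊗ V}. The abstract form of this argument
is `exists_orderIso_tensorSub`.

For tensor powers take U = F^t with the dot product and u = (1, …, 1), for which β(u, u) = t is
nonzero in F. Then Cl_V^{⊗ t} is Cl^{(u)}_{U ⊗ V} up to scalars. To identify u^⊥, write t = a² + b²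
in the prime field. The vector (a, b, 0, …, 0) has the same norm t as u, and its complement is
visibly ⟨t⟩ ⊕ F^{t-2}, the line being spanned by (-b, a, 0, …, 0). A reflection takes this vector to
±u, so u^⊥ is isometric to ⟨t⟩ ⊕ F^{t-2} (`exists_perp_equiv`). The same Schur argument then
identifies μ_{u^⊥ ⊗ V} with μ_V^{⊗(t-2)} ⊗ μ_V^{(t)} up to scalars, and the first half of the
theorem applies. Irreducible subrepresentations are the atoms of the lattice, so an order
isomorphism preserves them. -/

/-- The subrepresentations of a subrepresentation `K` are the subrepresentations below `K`. -/
def subrepresentationIic {W : Type*} [AddCommMonoid W] [Module ℂ W] {ρ : Representation ℂ G W}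
    (K : Subrepresentation ρ) : Subrepresentation K.toRepresentation ≃o Set.Iic K where
  toFun L := ⟨⟨L.toSubmodule.map K.toSubmodule.subtype, by
      rintro g _ ⟨x, hx, rfl⟩
      exact ⟨_, L.apply_mem_toSubmodule g hx, rfl⟩⟩, by
      rintro _ ⟨x, hx, rfl⟩
      exact x.2⟩
  invFun N := ⟨N.1.toSubmodule.comap K.toSubmodule.subtype, fun g x hx =>
    N.1.apply_mem_toSubmodule g hx⟩
  left_inv L := Subrepresentation.toSubmodule_injective
    (Submodule.comap_map_eq_of_injective K.toSubmodule.injective_subtype _)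
  right_inv N := Subtype.ext <| Subrepresentation.toSubmodule_injective <| by
    change Submodule.map _ (Submodule.comap _ _) = _
    rw [Submodule.map_comap_subtype]
    exact inf_eq_right.2 N.2
  map_rel_iff' {L L'} := Submodule.map_le_map_iff_of_injective K.toSubmodule.injective_subtype
    L.toSubmodule L'.toSubmodule

/-- The subrepresentations of `K` form the interval below `K`, and such an interval is a simple
order precisely when its top is an atom. Irreducibility thus depends only on the lattice, which is
what lets it pass along any order isomorphism. -/
theorem isIrreducibleSub_iff_isAtom {W : Type*} [AddCommMonoid W] [Module ℂ W]
    {ρ : Representation ℂ G W} (K : Subrepresentation ρ) : IsIrreducibleSub K ↔ IsAtom K :=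
  (subrepresentationIic K).isSimpleOrder_iff.trans Set.isSimpleOrder_Iic_iff_isAtom

theorem isIrreducibleSub_orderIso {W W' : Type*} [AddCommMonoid W] [Module ℂ W] [AddCommMonoid W']
    [Module ℂ W'] {ρ : Representation ℂ G W} {ρ' : Representation ℂ H W'}
    (e : Subrepresentation ρ ≃o Subrepresentation ρ') (K : Subrepresentation ρ) :
    IsIrreducibleSub K ↔ IsIrreducibleSub (e K) := by
  rw [isIrreducibleSub_iff_isAtom, isIrreducibleSub_iff_isAtom, e.isAtom_iff]

/-- Two representations are projectively equivalent through `Θ`. -/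
def ProjEquivVia {W W' : Type*} [AddCommMonoid W] [Module ℂ W] [AddCommMonoid W']
    [Module ℂ W'] (Θ : W ≃ₗ[ℂ] W') (ρ : Representation ℂ G W) (ρ' : Representation ℂ G W') : Prop :=
  ∀ g, ∃ c : ℂ, c ≠ 0 ∧ ∀ w, ρ' g (Θ w) = c • Θ (ρ g w)

/-- Projectively equivalent representations have the same lattice of subrepresentations. -/
def ProjEquivVia.orderIso {W W' : Type*} [AddCommMonoid W] [Module ℂ W] [AddCommMonoid W']
    [Module ℂ W'] {Θ : W ≃ₗ[ℂ] W'} {ρ : Representation ℂ G W} {ρ' : Representation ℂ G W'}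
    (h : ProjEquivVia Θ ρ ρ') : Subrepresentation ρ ≃o Subrepresentation ρ' where
  toFun K := ⟨K.toSubmodule.map Θ.toLinearMap, by
    rintro g _ ⟨x, hx, rfl⟩
    obtain ⟨c, -, hc⟩ := h g
    rw [LinearEquiv.coe_coe, hc]
    exact Submodule.smul_mem _ _ ⟨_, K.apply_mem_toSubmodule g hx, rfl⟩⟩
  invFun K := ⟨K.toSubmodule.comap Θ.toLinearMap, by
    intro g x hx
    obtain ⟨c, hc0, hc⟩ := h g
    -- The nonvanishing of the scalar is needed only in this direction, where it has to be divided
    -- out.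
    have h1 := Submodule.smul_mem _ c⁻¹ (K.apply_mem_toSubmodule g hx)
    rwa [LinearEquiv.coe_coe, hc, smul_smul, inv_mul_cancel₀ hc0, one_smul] at h1⟩
  left_inv K := Subrepresentation.toSubmodule_injective
    (Submodule.comap_map_eq_of_injective Θ.injective _)
  right_inv K := Subrepresentation.toSubmodule_injective
    (Submodule.map_comap_eq_of_surjective Θ.surjective _)
  map_rel_iff' {L L'} := Submodule.map_le_map_iff_of_injective Θ.injective
    L.toSubmodule L'.toSubmodule

variable (W) in
/-- The subspace `W ⊗ K` of `W ⊗ M`. -/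
def tensorSub (K : Submodule ℂ M) : Submodule ℂ (W ⊗[ℂ] M) :=
  Submodule.span ℂ {z | ∃ w : W, ∃ k ∈ K, w ⊗ₜ k = z}

theorem tmul_mem_tensorSub {K : Submodule ℂ M} (w : W) {k : M} (hk : k ∈ K) :
    w ⊗ₜ k ∈ tensorSub W K := Submodule.subset_span ⟨w, k, hk, rfl⟩

/-- The vectors `k` with `W ⊗ k ⊆ N`. -/
def tensorCore (N : Submodule ℂ (W ⊗[ℂ] M)) : Submodule ℂ M where
  carrier := {k | ∀ w : W, w ⊗ₜ k ∈ N}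
  zero_mem' := fun w => by simp
  add_mem' := fun ha hb w => by rw [TensorProduct.tmul_add]; exact N.add_mem (ha w) (hb w)
  smul_mem' := fun c k hk w => by rw [TensorProduct.tmul_smul]; exact N.smul_mem c (hk w)

/-- Contracting the first factor with a functional maps W ⊗ K into K. If the functional does not
vanish at w, the contraction of w ⊗ k is a nonzero multiple of k; such a w exists because W is not
zero. -/
theorem tensorCore_tensorSub [Nontrivial W] (K : Submodule ℂ M) :
    tensorCore (tensorSub W K) = K := by
  refine le_antisymm (fun k hk => ?_) fun k hk w => tmul_mem_tensorSub w hk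
  obtain ⟨w, hw⟩ := exists_ne (0 : W)
  obtain ⟨φ, hφ⟩ := Module.Projective.exists_dual_ne_zero ℂ hw
  let T : W ⊗[ℂ] M →ₗ[ℂ] M := (TensorProduct.lid ℂ M).toLinearMap.comp (LinearMap.rTensor M φ)
  have hT : tensorSub W K ≤ K.comap T := by
    refine Submodule.span_le.2 ?_
    rintro _ ⟨w, k, hk, rfl⟩
    simpa [T] using K.smul_mem _ hk
  have h1 : φ w • k ∈ K := by simpa [T] using hT (hk w)
  exact (K.smul_mem_iff hφ).1 h1

/-- Expand z along a basis of W, with coordinates in M obtained by contracting z with the dual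
basis. Tensoring such a coordinate with any w gives the image of z under a rank-one operator of W,
which lies in N by stability. Hence all the coordinates of z lie in the core. -/
theorem tensorSub_tensorCore [FiniteDimensional ℂ W] (N : Submodule ℂ (W ⊗[ℂ] M))
    (hN : ∀ (P : Module.End ℂ W), ∀ z ∈ N, LinearMap.rTensor M P z ∈ N) :
    tensorSub W (tensorCore N) = N := by
  refine le_antisymm (Submodule.span_le.2 ?_) fun z hz => ?_
  · rintro _ ⟨w, k, hk, rfl⟩
    exact hk w
  · let b := Module.finBasis ℂ W
    let T : Module.Dual ℂ W → W ⊗[ℂ] M →ₗ[ℂ] M := fun φ =>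
      (TensorProduct.lid ℂ M).toLinearMap.comp (LinearMap.rTensor M φ)
    have e1 : ∀ z : W ⊗[ℂ] M, ∑ i, b i ⊗ₜ T (b.coord i) z = z := fun z => by
      induction z using TensorProduct.induction_on with
      | zero => simp
      | add x y hx hy =>
        simp only [map_add, TensorProduct.tmul_add, Finset.sum_add_distrib, hx, hy]
      | tmul w k =>
        simp only [T, LinearMap.comp_apply, LinearMap.rTensor_tmul, LinearEquiv.coe_coe,
          TensorProduct.lid_tmul, TensorProduct.tmul_smul, TensorProduct.smul_tmul',
          Module.Basis.coord_apply]
        rw [← TensorProduct.sum_tmul, b.sum_repr]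
    have e2 : ∀ (φ : Module.Dual ℂ W) (w : W) (z : W ⊗[ℂ] M),
        w ⊗ₜ T φ z = LinearMap.rTensor M (φ.smulRight w) z := fun φ w z => by
      induction z using TensorProduct.induction_on with
      | zero => simp
      | add x y hx hy => simp only [map_add, TensorProduct.tmul_add, hx, hy]
      | tmul w' k => simp [T, TensorProduct.smul_tmul]
    rw [← e1 z]
    refine Submodule.sum_mem _ fun i _ => tmul_mem_tensorSub _ fun w => ?_
    rw [e2]
    exact hN _ z hz

/-- If operators of `G` act on `W ⊗ M` as all of `End W`, and the other ones act through `H` on `M`,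
then the `G`-invariant subspaces of `W ⊗ M` are the `W ⊗ K`, where `K` is `H`-invariant. -/
theorem exists_orderIso_tensorSub [Nontrivial W] [FiniteDimensional ℂ W]
    {ν : Representation ℂ H M} {ρ : Representation ℂ G E} (Θ : W ⊗[ℂ] M ≃ₗ[ℂ] E)
    {s : Set (Module.End ℂ W)} (hs : Submodule.span ℂ s = ⊤)
    (h1 : ∀ P ∈ s, ∃ g, ∀ z, ρ g (Θ z) = Θ (LinearMap.rTensor M P z))
    (h2 : ∀ g, ∃ (h : H) (P : Module.End ℂ W), ∀ w k, ρ g (Θ (w ⊗ₜ k)) = Θ (P w ⊗ₜ ν h k))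
    (h3 : ∀ h, ∃ (g : G) (P : Module.End ℂ W), P ≠ 0 ∧
      ∀ w k, ρ g (Θ (w ⊗ₜ k)) = Θ (P w ⊗ₜ ν h k)) :
    ∃ e : Subrepresentation ν ≃o Subrepresentation ρ,
      ∀ K, (e K).toSubmodule = (tensorSub W K.toSubmodule).map Θ.toLinearMap := by
  have full : ∀ N : Subrepresentation ρ, ∀ (P : Module.End ℂ W),
      ∀ z ∈ N.toSubmodule.comap Θ.toLinearMap,
        LinearMap.rTensor M P z ∈ N.toSubmodule.comap Θ.toLinearMap := by
    intro N P
    -- The operators on W that preserve N form a linear subspace. It contains `s`, so it is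
    -- everything.
    have : P ∈ Submodule.span ℂ s := by rw [hs]; trivial
    induction this using Submodule.span_induction with
    | mem P hP =>
      intro z hz
      obtain ⟨g, hg⟩ := h1 P hP
      change Θ _ ∈ N.toSubmodule
      rw [← hg]
      exact N.apply_mem_toSubmodule g hz
    | zero => intro z _; simp
    | add P Q _ _ hP hQ =>
      intro z hz
      rw [LinearMap.rTensor_add]
      exact Submodule.add_mem _ (hP z hz) (hQ z hz)
    | smul c P _ hP =>
      intro z hz
      rw [LinearMap.rTensor_smul]
      exact Submodule.smul_mem _ c (hP z hz)
  let f : Subrepresentation ν → Subrepresentation ρ := fun K =>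
    ⟨(tensorSub W K.toSubmodule).map Θ.toLinearMap, by
      intro g
      suffices h : (tensorSub W K.toSubmodule).map Θ.toLinearMap ≤
        ((tensorSub W K.toSubmodule).map Θ.toLinearMap).comap (ρ g) from h
      rw [Submodule.map_le_iff_le_comap]
      refine Submodule.span_le.2 ?_
      rintro _ ⟨w, k, hk, rfl⟩
      obtain ⟨h, P, hP⟩ := h2 g
      change ρ g (Θ _) ∈ (tensorSub W K.toSubmodule).map Θ.toLinearMap
      rw [hP]
      exact ⟨_, tmul_mem_tensorSub _ (K.apply_mem_toSubmodule h hk), rfl⟩⟩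
  let f' : Subrepresentation ρ → Subrepresentation ν := fun N =>
    ⟨tensorCore (N.toSubmodule.comap Θ.toLinearMap), by
      intro h k hk w
      obtain ⟨g, P, hP0, hP⟩ := h3 h
      obtain ⟨w0, hw0⟩ : ∃ w, P w ≠ 0 := by
        by_contra! h'
        exact hP0 (LinearMap.ext h')
      obtain ⟨φ, hφ⟩ := Module.Projective.exists_dual_ne_zero ℂ hw0
      -- The group element only yields vectors of the form P w ⊗ ν(h) k. One nonzero vector P w0
      -- suffices: the rank-one operator that sends it to the arbitrary w then gives w ⊗ ν(h) k.
      have a1 : P w0 ⊗ₜ ν h k ∈ N.toSubmodule.comap Θ.toLinearMap := by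
        change Θ _ ∈ N.toSubmodule
        rw [← hP]
        exact N.apply_mem_toSubmodule g (hk w0)
      have a2 := full N (((φ (P w0))⁻¹ • φ).smulRight w) _ a1
      simpa [hφ] using a2⟩
  refine ⟨⟨⟨f, f', fun K => Subrepresentation.toSubmodule_injective ?_, fun N =>
    Subrepresentation.toSubmodule_injective ?_⟩, fun {K L} => ⟨fun h => ?_, fun h => ?_⟩⟩,
    fun K => rfl⟩
  · change tensorCore (Submodule.comap _ (Submodule.map _ _)) = _
    rw [Submodule.comap_map_eq_of_injective Θ.injective, tensorCore_tensorSub]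
  · change Submodule.map _ (tensorSub W (tensorCore _)) = _
    rw [tensorSub_tensorCore _ (full N), Submodule.map_comap_eq_of_surjective Θ.surjective]
  · have h' := (Submodule.map_le_map_iff_of_injective Θ.injective _ _).1 h
    -- The inclusion W ⊗ K ⊆ W ⊗ L is turned back into K ⊆ L by passing to cores.
    intro k hk
    have : k ∈ tensorCore (tensorSub W L.toSubmodule) :=
      fun w => h' (tmul_mem_tensorSub w hk)
    rwa [tensorCore_tensorSub] at this
  · refine Submodule.map_mono (Submodule.span_mono ?_)
    rintro _ ⟨w, k, hk, rfl⟩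
    exact ⟨w, k, h hk, rfl⟩

end Lattice

/-! ### Weyl operators span all operators -/

section WeylSpan

variable {F X Y : Type*} [Field F] [AddCommGroup X] [Module F X] [AddCommGroup Y] [Module F Y]
  [NeZero (2 : F)] {B : X →ₗ[F] Y →ₗ[F] F} {ψ : AddChar F ℂ}

/-- The Weyl operators span the algebra of all operators. -/
theorem span_weylOp [Finite X] [Finite Y] (hB : B.Nondegenerate) (hψ : ψ ≠ 1) :
    Submodule.span ℂ (Set.range (weylOp B ψ)) = ⊤ := by
  classical
  cases nonempty_fintype X
  cases nonempty_fintype Y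
  have h1 : ∀ z0 w0 : Y, (LinearMap.proj z0).smulRight (Pi.single w0 1 : Y → ℂ)
      ∈ Submodule.span ℂ (Set.range (weylOp B ψ)) := by
    intro z0 w0
    -- The matrix unit f ↦ f(z0) δ_{w0} comes out of Fourier inversion over X: the translation part
    -- w0 - z0 carries z0 to w0, and the phase is chosen so that the total exponent at z is ⟨x, z -
    -- w0⟩. Its character sum over x is |X| for z = w0 and vanishes otherwise, by nondegeneracy.
    have e : (LinearMap.proj z0).smulRight (Pi.single w0 1 : Y → ℂ)
        = (Fintype.card X : ℂ)⁻¹ • ∑ x : X,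
          ψ (-(B x z0) + -(2⁻¹ * B x (w0 - z0))) • weylOp B ψ (x, w0 - z0) := by
      have hc : (Fintype.card X : ℂ) ≠ 0 := by exact_mod_cast Fintype.card_ne_zero
      refine LinearMap.ext fun f => funext fun z => ?_
      simp only [LinearMap.smulRight_apply, LinearMap.proj_apply, Pi.smul_apply, smul_eq_mul,
        LinearMap.smul_apply, LinearMap.sum_apply, Finset.sum_apply, weylOp_apply, ← mul_assoc,
        ← AddChar.map_add_eq_mul]
      rw [← Finset.sum_mul]
      have e2 : ∀ x, -(B x z0) + -(2⁻¹ * B x (w0 - z0)) + (B x z - 2⁻¹ * B x (w0 - z0))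
          = B.flip (z - w0) x := fun x => by
        have h2 : (2 : F) ≠ 0 := NeZero.ne 2
        simp only [LinearMap.flip_apply, LinearMap.sub_apply, map_sub]
        field_simp
        ring
      simp only [e2]
      by_cases hz : z = w0
      · subst hz
        simp [hc]
      · rw [sum_char ψ hψ (l := B.flip (z - w0)) (fun h => hz (sub_eq_zero.1
          (hB.2 _ fun x => by simpa using LinearMap.congr_fun h x)))]
        simp [hz]
    rw [e]
    exact Submodule.smul_mem _ _ (Submodule.sum_mem _ fun x _ => Submodule.smul_mem _ _
      (Submodule.subset_span ⟨_, rfl⟩))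
  refine eq_top_iff.2 fun P _ => ?_
  have e : P = ∑ z0 : Y, ∑ w0 : Y,
      P (Pi.single z0 1) w0 • (LinearMap.proj z0).smulRight (Pi.single w0 1 : Y → ℂ) := by
    refine (Pi.basisFun ℂ Y).ext fun z => funext fun w => ?_
    simp [Pi.single_apply, ite_apply]
  rw [e]
  exact Submodule.sum_mem _ fun z _ => Submodule.sum_mem _ fun w _ => Submodule.smul_mem _ _ (h1 z w)

end WeylSpan

/-! ### Operators that intertwine Weyl operators -/

section Intertwine

variable {F X Y : Type*} [Field F] [AddCommGroup X] [Module F X] [AddCommGroup Y] [Module F Y]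
  [NeZero (2 : F)] {B : X →ₗ[F] Y →ₗ[F] F} {ψ : AddChar F ℂ}

theorem weylOp_add (v w : X × Y) : weylOp B ψ (v + w)
    = ψ (-(2⁻¹ * sympForm B v w)) • (weylOp B ψ v * weylOp B ψ w) := by
  rw [weylOp_mul, smul_smul, ← AddChar.map_add_eq_mul]
  simp

/-- Since S preserves the symplectic form, the cocycles that appear when a Weyl operator at a sum is
factored agree on both sides. Intertwining therefore needs to be checked only on additive
generators. -/
theorem mul_weylOp_add {S : SpGroup B} {R : Module.End ℂ (Y → ℂ)} {v w : X × Y}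
    (hv : R * weylOp B ψ v = weylOp B ψ (S.1 v) * R)
    (hw : R * weylOp B ψ w = weylOp B ψ (S.1 w) * R) :
    R * weylOp B ψ (v + w) = weylOp B ψ (S.1 (v + w)) * R := by
  rw [map_add, weylOp_add, weylOp_add, S.2 v w, mul_smul_comm, ← mul_assoc, hv, mul_assoc, hw,
    smul_mul_assoc, mul_assoc]

theorem oscillator_intertwines [Finite F] [Module.Finite F X] [Module.Finite F Y]
    (hB : B.Nondegenerate) (hψ : ψ ≠ 1) (S : SpGroup B) :
    Intertwines B ψ S (oscillator B hB ψ hψ S) :=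
  fun v => oscillator_mul_weyl hB hψ S ⟨0, v⟩

/-- Operators of a representation are invertible. This supplies the nonvanishing that the uniqueness
of intertwiners requires, and shows that the resulting scalars are nonzero. -/
theorem representation_ne_zero {G W : Type*} [Group G] [AddCommGroup W] [Module ℂ W] [Nontrivial W]
    (ρ : Representation ℂ G W) (g : G) : ρ g ≠ 0 := by
  intro h
  have h1 : ρ g * ρ g⁻¹ = 1 := by rw [← map_mul, mul_inv_cancel, map_one]
  rw [h, zero_mul] at h1
  exact zero_ne_one h1

end Intertwine

/-! ### Functions on products as tensor products -/

section FunTensor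

variable {Y Z : Type*} [Finite Y] [Finite Z]

/-- Functions on a product are tensor products of functions. -/
def funTensor (Y Z : Type*) [Finite Y] [Finite Z] :
    (Y → ℂ) ⊗[ℂ] (Z → ℂ) ≃ₗ[ℂ] (Y × Z → ℂ) :=
  ((Pi.basisFun ℂ Y).tensorProduct (Pi.basisFun ℂ Z)).equivFun

theorem funTensor_tmul (f : Y → ℂ) (k : Z → ℂ) (a : Y × Z) :
    funTensor Y Z (f ⊗ₜ k) a = f a.1 * k a.2 := by
  exact (Module.Basis.tensorProduct_repr_tmul_apply _ _ f k a.1 a.2).trans (by simp [mul_comm])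

/-- Functions on a power are tensor products of functions. -/
def funPiTensor (ι Y : Type*) [Finite ι] [Finite Y] :
    (⨂[ℂ] _ : ι, (Y → ℂ)) ≃ₗ[ℂ] ((ι → Y) → ℂ) :=
  (Basis.piTensorProduct fun _ : ι => Pi.basisFun ℂ Y).equivFun

theorem funPiTensor_tprod {ι : Type*} [Fintype ι] (f : ι → Y → ℂ) (y : ι → Y) :
    funPiTensor ι Y (PiTensorProduct.tprod ℂ f) y = ∏ i, f i (y i) := by
  simp [funPiTensor]

end FunTensor

/-! ### The representations on functions on Hom(X, U) -/

section Concrete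

variable (p : ℕ) [Fact p.Prime] {F : Type*} [Field F] [Finite F] [NeZero (2 : F)]
  [Algebra (ZMod p) F] (X : Type*) [AddCommGroup X] [Module F X] [FiniteDimensional F X]
  {U U' : Type*} [AddCommGroup U] [Module F U] [FiniteDimensional F U]
  [AddCommGroup U'] [Module F U'] [FiniteDimensional F U']

theorem omega_eq (m : Fˣ) (a : F) : omega p m a = omega p 1 (m * a) := by
  simp [omega_apply]

theorem muU_intertwines {β : LinearMap.BilinForm F U} (hs : β.IsSymm) (hn : β.Nondegenerate)
    (S : SpGroup (evalPairing (F := F) X)) :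
    Intertwines (tensorPairing X β) (omega p 1) (spEmbed hs S) (muU p X hs hn S) :=
  oscillator_intertwines _ _ _

/-- An operator that intertwines enough Weyl operators is a multiple of `μ_{U ⊗ V}(S)`. -/
theorem muU_eq_smul {β : LinearMap.BilinForm F U} (hs : β.IsSymm) (hn : β.Nondegenerate)
    (S : SpGroup (evalPairing (F := F) X)) {R : Module.End ℂ ((X →ₗ[F] U) → ℂ)} (hR : R ≠ 0)
    {s : Set U} (hspan : Submodule.span F s = ⊤)
    (h : ∀ w ∈ s, ∀ v,
      R * weylOp (tensorPairing X β) (omega p 1) (tensorV X (w ⊗ₜ v))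
        = weylOp (tensorPairing X β) (omega p 1) (tensorV X (w ⊗ₜ S.1 v)) * R) :
    ∃ c : ℂ, c ≠ 0 ∧ muU p X hs hn S = c • R := by
  have : Finite (U ⊗[F] X) := Module.finite_of_finite F
  have : Finite (X →ₗ[F] U) := Module.finite_of_finite F
  -- The hypothesis is extended in two stages: from `s` to all w in U, and then from pure tensors to
  -- all of U ⊗ V.
  have h1 : ∀ w v, R * weylOp (tensorPairing X β) (omega p 1) (tensorV X (w ⊗ₜ v))
      = weylOp (tensorPairing X β) (omega p 1) ((spEmbed hs S).1 (tensorV X (w ⊗ₜ v))) * R := by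
    intro w
    have hw : w ∈ Submodule.span F s := by rw [hspan]; trivial
    induction hw using Submodule.span_induction with
    | mem w hw => intro v; rw [spEmbed_tmul, h w hw]
    | zero =>
      intro v
      have : weylOp (tensorPairing X β) (omega p 1) 0 = 1 := map_one (weyl _ _)
      simp [this]
    | add w w' _ _ hw hw' =>
      intro v
      rw [TensorProduct.add_tmul, map_add]
      exact mul_weylOp_add (hw v) (hw' v)
    -- The scalar moves across the tensor sign onto v, which is arbitrary.
    | smul a w _ hw => intro v; rw [TensorProduct.smul_tmul, hw]
  have h2 : Intertwines (tensorPairing X β) (omega p 1) (spEmbed hs S) R := by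
    intro v
    obtain ⟨z, rfl⟩ := (tensorV X).surjective v
    induction z using TensorProduct.induction_on with
    | zero => rw [← TensorProduct.zero_tmul U (0 : X × Module.Dual F X)]; exact h1 _ _
    | add a b ha hb => rw [map_add]; exact mul_weylOp_add ha hb
    | tmul w v => exact h1 w v
  obtain ⟨c, hc⟩ := Intertwines.eq_smul (tensorPairing_nondegenerate X hn) (omega_ne_one p 1)
    (muU_intertwines p X hs hn S) h2 hR
  refine ⟨c, ?_, hc⟩
  rintro rfl
  exact representation_ne_zero (muU p X hs hn) S (by rw [hc, zero_smul])

/-! ### Splitting off a line: L²(Hom(X, U)) as L²(X*) ⊗ L²(Hom(X, U')) -/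

section Split

variable {X}

/-- The decomposition of `Hom(X, U)` that a decomposition of `U` induces. -/
def homSplit (E : (F × U') ≃ₗ[F] U) : (Module.Dual F X × (X →ₗ[F] U')) ≃ₗ[F] (X →ₗ[F] U) :=
  (LinearMap.prodEquiv F).trans (LinearEquiv.congrRight E)

theorem homSplit_apply (E : (F × U') ≃ₗ[F] U) (a : Module.Dual F X × (X →ₗ[F] U')) (x : X) :
    homSplit E a x = E (a.1 x, a.2 x) := rfl

instance : Finite (Module.Dual F X) := Module.finite_of_finite F

instance : Finite (X →ₗ[F] U) := Module.finite_of_finite F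

/-- The decomposition of the functions on `Hom(X, U)` that a decomposition of `U` induces. -/
def funSplit (E : (F × U') ≃ₗ[F] U) :
    (Module.Dual F X → ℂ) ⊗[ℂ] ((X →ₗ[F] U') → ℂ) ≃ₗ[ℂ] ((X →ₗ[F] U) → ℂ) :=
  (funTensor _ _).trans (LinearEquiv.funCongrLeft ℂ ℂ (homSplit E).symm.toEquiv)

theorem funSplit_tmul (E : (F × U') ≃ₗ[F] U) (f : Module.Dual F X → ℂ)
    (k : (X →ₗ[F] U') → ℂ) (a : Module.Dual F X × (X →ₗ[F] U')) :
    funSplit E (f ⊗ₜ k) (homSplit E a) = f a.1 * k a.2 := by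
  change funTensor _ _ (f ⊗ₜ k) ((homSplit E).symm (homSplit E a)) = _
  rw [LinearEquiv.symm_apply_apply, funTensor_tmul]

variable {β : LinearMap.BilinForm F U} {β' : LinearMap.BilinForm F U'} {b : Fˣ}
  {E : (F × U') ≃ₗ[F] U}

/-- The translation by E(1, 0) ⊗ y moves only the X* coordinate, and the phase pairs only with that
coordinate because the two summands are orthogonal. The pairing is multiplied by the norm b of E(1,
0), and this factor is absorbed into the character: mass 1 becomes mass b. -/
theorem weylOp_split_left
    (hE : ∀ a w a' w', β (E (a, w)) (E (a', w')) = b * (a * a') + β' w w')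
    (v : X × Module.Dual F X) (f : Module.Dual F X → ℂ)
    (k : (X →ₗ[F] U') → ℂ) :
    weylOp (tensorPairing X β) (omega p 1) (tensorV X (E (1, 0) ⊗ₜ v)) (funSplit E (f ⊗ₜ k))
      = funSplit E (weylOp (evalPairing X) (omega p b) v f ⊗ₜ k) := by
  ext G
  obtain ⟨a, rfl⟩ := (homSplit E).surjective G
  have e : homSplit E a - v.2.smulRight (E (1, 0)) = homSplit E (a.1 - v.2, a.2) := by
    ext x
    simp only [LinearMap.sub_apply, LinearMap.smulRight_apply, homSplit_apply, ← map_smul,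
      ← map_sub]
    simp
  rw [weylOp_apply, tensorV_tmul, funSplit_tmul]
  simp only [e, tensorPairing_tmul, funSplit_tmul, homSplit_apply, LinearMap.smulRight_apply,
    ← map_smul E, hE, weylOp_apply, Prod.smul_mk, smul_zero]
  rw [omega_eq p b, ← mul_assoc]
  congr 3
  simp [Module.Dual.eval_apply]
  ring

/-- By the same orthogonality, vectors of the second summand act on the second factor alone. As `E`
is isometric on this summand, the mass stays 1. -/
theorem weylOp_split_right
    (hE : ∀ a w a' w', β (E (a, w)) (E (a', w')) = b * (a * a') + β' w w')
    (w : U') (v : X × Module.Dual F X) (f : Module.Dual F X → ℂ)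
    (k : (X →ₗ[F] U') → ℂ) :
    weylOp (tensorPairing X β) (omega p 1) (tensorV X (E (0, w) ⊗ₜ v)) (funSplit E (f ⊗ₜ k))
      = funSplit E (f ⊗ₜ weylOp (tensorPairing X β') (omega p 1) (tensorV X (w ⊗ₜ v)) k) := by
  ext G
  obtain ⟨a, rfl⟩ := (homSplit E).surjective G
  have e : homSplit E a - v.2.smulRight (E (0, w)) = homSplit E (a.1, a.2 - v.2.smulRight w) := by
    ext x
    simp only [LinearMap.sub_apply, LinearMap.smulRight_apply, homSplit_apply, ← map_smul,
      ← map_sub]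
    simp
  rw [weylOp_apply, tensorV_tmul, funSplit_tmul]
  simp only [e, tensorPairing_tmul, funSplit_tmul, homSplit_apply, LinearMap.smulRight_apply,
    ← map_smul E, hE, weylOp_apply, Prod.smul_mk, tensorV_tmul]
  rw [mul_left_comm]
  simp

/-- `μ_{U ⊗ V}(S)` splits up to a scalar. -/
theorem muU_split
    (hE : ∀ a w a' w', β (E (a, w)) (E (a', w')) = b * (a * a') + β' w w')
    (hs : β.IsSymm) (hn : β.Nondegenerate) (hs' : β'.IsSymm)
    (hn' : β'.Nondegenerate) (S : SpGroup (evalPairing (F := F) X)) :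
    ∃ c : ℂ, c ≠ 0 ∧ ∀ z, muU p X hs hn S (funSplit E z)
      = c • funSplit E (TensorProduct.map (muV p X b S) (muU p X hs' hn' S) z) := by
  -- `R` is the tensor product operator transported to the functions on Hom(X, U). Schur's lemma
  -- compares it with μ_{U ⊗ V}(S).
  let R : Module.End ℂ ((X →ₗ[F] U) → ℂ) := (funSplit E).toLinearMap ∘ₗ
    (Representation.tprod (muV p X b) (muU p X hs' hn') S) ∘ₗ (funSplit E).symm.toLinearMap
  have hR : ∀ z, R (funSplit E z)
      = funSplit E (TensorProduct.map (muV p X b S) (muU p X hs' hn' S) z) := fun z => by simp [R]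
  have hR0 : R ≠ 0 := by
    intro h
    have : Nontrivial ((Module.Dual F X → ℂ) ⊗[ℂ] ((X →ₗ[F] U') → ℂ)) :=
      (funSplit E).toEquiv.nontrivial
    refine representation_ne_zero (Representation.tprod (muV p X b) (muU p X hs' hn')) S
      (LinearMap.ext fun z => ?_)
    have := hR z
    rw [h, LinearMap.zero_apply, eq_comm, LinearEquiv.map_eq_zero_iff] at this
    exact this
  have ext' : ∀ {P Q : Module.End ℂ ((X →ₗ[F] U) → ℂ)},
      (∀ f k, P (funSplit E (f ⊗ₜ k)) = Q (funSplit E (f ⊗ₜ k))) → P = Q := fun {P Q} h => by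
    have : P ∘ₗ (funSplit E).toLinearMap = Q ∘ₗ (funSplit E).toLinearMap :=
      TensorProduct.ext' h
    refine LinearMap.ext fun x => ?_
    simpa using LinearMap.congr_fun this ((funSplit E).symm x)
  -- Intertwining is tested on a spanning set of U adapted to the splitting, so that each test
  -- involves only one of the two tensor factors.
  obtain ⟨c, hc0, hc⟩ := muU_eq_smul p X hs hn S hR0
    (s := insert (E (1, 0)) (Set.range fun w => E (0, w))) (by
      refine eq_top_iff.2 fun u _ => ?_
      obtain ⟨⟨a, w⟩, rfl⟩ := E.surjective u
      have : E (a, w) = a • E (1, 0) + E (0, w) := by rw [← map_smul, ← map_add]; simp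
      rw [this]
      exact Submodule.add_mem _ (Submodule.smul_mem _ _ (Submodule.subset_span (Or.inl rfl)))
        (Submodule.subset_span (Or.inr ⟨w, rfl⟩))) (by
      rintro _ (rfl | ⟨w, rfl⟩) v
      · refine ext' fun f k => ?_
        have := LinearMap.congr_fun (oscillator_intertwines (evalPairing_nondegenerate X)
          (omega_ne_one p b) S v) f
        simp only [Module.End.mul_apply] at this ⊢
        rw [weylOp_split_left p hE, hR, hR, TensorProduct.map_tmul, TensorProduct.map_tmul,
          weylOp_split_left p hE]
        congr 2
      · refine ext' fun f k => ?_
        have := LinearMap.congr_fun (muU_intertwines p X hs' hn' S (tensorV X (w ⊗ₜ v))) k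
        simp only [Module.End.mul_apply] at this ⊢
        rw [weylOp_split_right p hE, hR, hR, TensorProduct.map_tmul, TensorProduct.map_tmul,
          weylOp_split_right p hE, this, spEmbed_tmul])
  exact ⟨c, hc0, fun z => by rw [hc, LinearMap.smul_apply, hR]⟩

/-- The invariant subspaces of `Cl^{(u)}_{U ⊗ V}` are the spaces `L²(X*) ⊗ K`. -/
theorem exists_orderIso_clU
    (hE : ∀ a w a' w', β (E (a, w)) (E (a', w')) = b * (a * a') + β' w w')
    (hs : β.IsSymm) (hn : β.Nondegenerate) (hs' : β'.IsSymm) (hn' : β'.Nondegenerate) {u : U}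
    (hu : E (1, 0) = u) :
    ∃ e : Subrepresentation (muU p X hs' hn') ≃o Subrepresentation (clU p X hs hn u),
      ∀ K, (e K).toSubmodule
        = (tensorSub (Module.Dual F X → ℂ) K.toSubmodule).map (funSplit E).toLinearMap := by
  subst hu
  have : Finite X := Module.finite_of_finite F
  -- The elements (0, v, 1) act as mass-b Weyl operators on the first factor, and these span its
  -- endomorphisms. An element (c, v, S) acts as a pure tensor with second component μ_{U' ⊗ V}(S),
  -- all scalars being put into the first component. Conversely, each S is reached by the element
  -- with trivial Heisenberg part.
  refine exists_orderIso_tensorSub (funSplit E)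
    (span_weylOp (evalPairing_nondegenerate X) (omega_ne_one p b)) ?_ ?_ ?_
  · rintro _ ⟨v, rfl⟩
    refine ⟨⟨⟨0, v⟩, 1⟩, fun z => ?_⟩
    have hz : clU p X hs hn (E (1, 0)) ⟨⟨0, v⟩, 1⟩
        = weylOp (tensorPairing X β) (omega p 1) (tensorV X (E (1, 0) ⊗ₜ v)) := by
      rw [clU_apply]
      simp [heisEmbed, weylOp]
    rw [hz]
    induction z using TensorProduct.induction_on with
    | zero => simp
    | add a b ha hb => simp only [map_add, ha, hb]
    | tmul f k => rw [weylOp_split_left p hE, LinearMap.rTensor_tmul]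
  · intro g
    obtain ⟨c, -, hc⟩ := muU_split p hE hs hn hs' hn' g.right
    refine ⟨g.right, (omega p 1 (β (E (1, 0)) (E (1, 0)) * g.left.c) * c) •
      (weylOp (evalPairing X) (omega p b) g.left.v * muV p X b g.right), fun w k => ?_⟩
    rw [clU_apply, Module.End.mul_apply, hc, weyl_eq]
    change (omega p 1 (β (E (1, 0)) (E (1, 0)) * g.left.c) •
      weylOp (tensorPairing X β) (omega p 1) (tensorV X (E (1, 0) ⊗ₜ g.left.v))) _ = _
    rw [map_smul, TensorProduct.map_tmul, LinearMap.smul_apply, weylOp_split_left p hE, smul_smul,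
      mul_comm, LinearMap.smul_apply, ← TensorProduct.smul_tmul', map_smul]
    rfl
  · intro S
    obtain ⟨c, hc0, hc⟩ := muU_split p hE hs hn hs' hn' S
    refine ⟨⟨1, S⟩, c • muV p X b S, smul_ne_zero hc0 (representation_ne_zero _ _), fun w k => ?_⟩
    rw [clU_apply, map_one, map_one, one_mul, hc, TensorProduct.map_tmul, LinearMap.smul_apply,
      ← TensorProduct.smul_tmul', map_smul]

/-- In the coordinates of `homSplit`, the map with components y and G is u ⊗ y + G. Every element of
Hom(X, U) has this form, so the product formula in `tensorWith` determines the function and makes it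
the image of φ ⊗ k. -/
theorem map_funSplit_tensorSub {u : U} (E : (F × perp β u) ≃ₗ[F] U)
    (hEu : ∀ a w, E (a, w) = a • u + w) (K : Submodule ℂ ((X →ₗ[F] perp β u) → ℂ)) :
    (tensorSub (Module.Dual F X → ℂ) K).map (funSplit E).toLinearMap = tensorWith X β u K := by
  have h : ∀ (y : Module.Dual F X) (G : X →ₗ[F] perp β u),
      y.smulRight u + (perp β u).subtype.comp G = homSplit E (y, G) := fun y G => by
    ext x
    simp [homSplit_apply, hEu]
  rw [tensorSub, tensorWith, Submodule.map_span]
  congr 1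
  ext f
  constructor
  · rintro ⟨_, ⟨φ, k, hk, rfl⟩, rfl⟩
    refine ⟨φ, k, hk, fun y G => ?_⟩
    rw [h]
    exact funSplit_tmul _ _ _ _
  · rintro ⟨φ, k, hk, hf⟩
    refine ⟨_, ⟨φ, k, hk, rfl⟩, funext fun G => ?_⟩
    obtain ⟨⟨y, G⟩, rfl⟩ := (homSplit E).surjective G
    rw [← h, hf, h]
    exact funSplit_tmul _ _ _ _

/-- The invariant subspaces of `Cl^{(u)}_{U ⊗ V}` are the spaces `L²(X*) ⊗ K`, where `K` is an
invariant subspace of `μ_{u^⊥ ⊗ V}`. -/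
theorem exists_orderIso_tensorWith (hs : β.IsSymm) (hn : β.Nondegenerate) {u : U}
    (hu : β u u ≠ 0) :
    ∃ e : Subrepresentation (muU p X (perp_isSymm hs u) (perp_nondegenerate hs hn hu))
          ≃o Subrepresentation (clU p X hs hn u),
        ∀ K, (e K).toSubmodule = tensorWith X β u K.toSubmodule := by
  have hu0 : u ≠ 0 := by rintro rfl; simp at hu
  -- As u is not isotropic, U is the direct sum of the line through u and its orthogonal complement.
  let E : (F × perp β u) ≃ₗ[F] U :=
    (LinearEquiv.prodCongr (LinearEquiv.toSpanNonzeroSingleton F U u hu0)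
      (LinearEquiv.refl F _)).trans (Submodule.prodEquivOfIsCompl _ _
        (LinearMap.BilinForm.isCompl_span_singleton_orthogonal hu))
  have hEu : ∀ a w, E (a, w) = a • u + w := fun a w => rfl
  have hw : ∀ w : perp β u, β u w = 0 := fun w => w.2 u (Submodule.mem_span_singleton_self u)
  obtain ⟨e, he⟩ := exists_orderIso_clU (X := X) (U := U) p (U' := perp β u)
    (β' := β.restrict (perp β u)) (b := Units.mk0 _ hu) (E := E) (fun a w a' w' => by
    have h2 : β w u = 0 := by rw [← hw w]; exact hs.eq _ _
    simp [hEu, hw, h2]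
    ring) hs hn (perp_isSymm hs u) (perp_nondegenerate hs hn hu)
    (u := u) (by simp [hEu])
  exact ⟨e, fun K => by rw [he, map_funSplit_tensorSub E hEu]⟩

end Split

end Concrete

/-! ### Isometries and the orthogonal complement of (1, …, 1) -/

section Isometry

variable {F : Type*} [Field F] {U : Type*} [AddCommGroup U] [Module F U]

/-- The reflection in the hyperplane orthogonal to `w`. -/
def reflect (β : LinearMap.BilinForm F U) (w : U) : U →ₗ[F] U :=
  LinearMap.id - (2 * (β w w)⁻¹) • (β w).smulRight w

theorem reflect_apply (β : LinearMap.BilinForm F U) (w z : U) :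
    reflect β w z = z - (2 * (β w w)⁻¹ * β w z) • w := by
  simp [reflect, smul_smul]

theorem reflect_isometry {β : LinearMap.BilinForm F U} (hs : β.IsSymm) {w : U} (hw : β w w ≠ 0)
    (x y : U) : β (reflect β w x) (reflect β w y) = β x y := by
  simp only [reflect_apply, map_sub, map_smul, LinearMap.sub_apply, LinearMap.smul_apply,
    smul_eq_mul]
  rw [show β x w = β w x from hs.eq x w]
  field_simp
  ring

/-- An isometry maps a non-isotropic vector to a given vector of the same norm, up to sign. -/
theorem exists_isometry [NeZero (2 : F)] {β : LinearMap.BilinForm F U} (hs : β.IsSymm) {x y : U}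
    (hxy : β x x = β y y) (hx : β x x ≠ 0) :
    ∃ r : U →ₗ[F] U, (∀ z z', β (r z) (r z') = β z z') ∧ (r x = y ∨ r x = -y) := by
  have h2 : (2 : F) ≠ 0 := NeZero.ne 2
  have hyx : β y x = β x y := hs.eq y x
  have e1 : β (x - y) (x - y) = 2 * (β x x - β x y) := by
    simp [hyx, ← hxy]; ring
  have e2 : β (x + y) (x + y) = 2 * (β x x + β x y) := by
    simp [hyx, ← hxy]; ring
  -- The norms of x - y and x + y add up to 4β(x, x), which is nonzero, so at least one of the two
  -- vectors is not isotropic. Reflecting in x - y sends x to y, and reflecting in x + y sends x to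
  -- -y.
  by_cases h : β (x - y) (x - y) = 0
  · have h' : β x x + β x y ≠ 0 := by
      intro h'
      rw [e1, mul_eq_zero, or_iff_right h2] at h
      refine mul_ne_zero h2 hx ?_
      linear_combination h + h'
    have h'' : β (x + y) (x + y) ≠ 0 := by rw [e2]; exact mul_ne_zero h2 h'
    refine ⟨reflect β (x + y), reflect_isometry hs h'', Or.inr ?_⟩
    -- Equality of the norms of x and y makes β(x + y, x) half the norm of x + y, so the reflection
    -- subtracts x + y exactly once.
    have : 2 * (β (x + y) (x + y))⁻¹ * β (x + y) x = 1 := by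
      rw [e2]; simp only [map_add, LinearMap.add_apply, hyx]; field_simp
    rw [reflect_apply, this]
    simp
  · have h' : β x x - β x y ≠ 0 := fun h' => h (by rw [e1, h', mul_zero])
    refine ⟨reflect β (x - y), reflect_isometry hs h, Or.inl ?_⟩
    have : 2 * (β (x - y) (x - y))⁻¹ * β (x - y) x = 1 := by
      rw [e1]; simp only [map_sub, LinearMap.sub_apply, hyx]; field_simp
    rw [reflect_apply, this]
    simp

variable [NeZero (2 : F)]

/-- The standard symmetric bilinear form. -/
def dotForm (F : Type*) [Field F] [NeZero (2 : F)] (n : ℕ) : LinearMap.BilinForm F (Fin n → F) :=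
  diagForm fun _ => 1

theorem dotForm_apply {n : ℕ} (z w : Fin n → F) : dotForm F n z w = ∑ i, z i * w i := by
  rw [dotForm, diagForm_apply]
  simp

theorem dotForm_isSymm (n : ℕ) : (dotForm F n).IsSymm := ⟨fun z w => diagForm_symm _ z w⟩

theorem dotForm_nondegenerate (n : ℕ) : (dotForm F n).Nondegenerate :=
  ⟨diagForm_nondeg fun _ => one_ne_zero, fun z h => diagForm_nondeg (fun _ => one_ne_zero) z
    fun w => by rw [diagForm_symm]; exact h w⟩

theorem dotForm_one (n : ℕ) : dotForm F n (fun _ => 1) (fun _ => 1) = n := by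
  simp [dotForm_apply]

/-- If `t = n + 2` is a sum of two squares, then the orthogonal complement of `(1, …, 1)` in `F ^ t`
is isometric to `⟨t⟩ ⊕ F ^ n`. -/
theorem exists_perp_equiv {n : ℕ} {a b : F}
    (hab : a ^ 2 + b ^ 2 = ((n + 2 : ℕ) : F)) (ht : ((n + 2 : ℕ) : F) ≠ 0) :
    ∃ E : (F × (Fin n → F)) ≃ₗ[F] perp (dotForm F (n + 2)) (fun _ => 1), ∀ c w c' w',
      (dotForm F (n + 2)).restrict (perp (dotForm F (n + 2)) (fun _ => 1)) (E (c, w)) (E (c', w'))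
        = ((n + 2 : ℕ) : F) * (c * c') + dotForm F n w w' := by
  let β := dotForm F (n + 2)
  let u : Fin (n + 2) → F := fun _ => 1
  -- `u0` = (a, b, 0, …, 0) has norm a² + b² = t. Its complement is parametrized by `L0`, which
  -- sends (c, w) to (-bc, ac, w); the vector (-b, a, 0, …, 0) again has norm t.
  let u0 : Fin (n + 2) → F := Fin.cons a (Fin.cons b 0)
  let L0 : (F × (Fin n → F)) →ₗ[F] (Fin (n + 2) → F) :=
    { toFun := fun z => Fin.cons (-(b * z.1)) (Fin.cons (a * z.1) z.2)
      map_add' := fun z z' => by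
        ext i
        refine Fin.cases ?_ (Fin.cases ?_ fun i => ?_) i
        · simp; ring
        · simp; ring
        · simp
      map_smul' := fun c z => by
        ext i
        refine Fin.cases ?_ (Fin.cases ?_ fun i => ?_) i
        · simp; ring
        · simp; ring
        · simp }
  have hu : β u u = ((n + 2 : ℕ) : F) := dotForm_one _
  have hu0 : β u0 u0 = ((n + 2 : ℕ) : F) := by
    rw [← hab]
    simp only [β, dotForm_apply, Fin.sum_univ_succ, u0, Fin.cons_zero, Fin.cons_succ]
    simp
    ring
  have hL0 : ∀ z, β u0 (L0 z) = 0 := fun z => by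
    simp only [β, dotForm_apply, Fin.sum_univ_succ, u0, L0, Fin.cons_zero, Fin.cons_succ,
      LinearMap.coe_mk, AddHom.coe_mk]
    simp
    ring
  have hLL : ∀ z z', β (L0 z) (L0 z') = ((n + 2 : ℕ) : F) * (z.1 * z'.1) + dotForm F n z.2 z'.2 :=
    fun z z' => by
    rw [← hab]
    simp only [β, dotForm_apply, Fin.sum_univ_succ, L0, Fin.cons_zero, Fin.cons_succ,
      LinearMap.coe_mk, AddHom.coe_mk]
    ring
  -- The isometry carries `u0` to `u` or to its negative. The sign is harmless, since both have the
  -- same orthogonal complement.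
  obtain ⟨r, hr, hru⟩ := exists_isometry (dotForm_isSymm (F := F) (n + 2)) (hu0.trans hu.symm)
    (hu0.trans_ne ht)
  have hperp : ∀ z, r (L0 z) ∈ perp β u := fun z => by
    rw [LinearMap.BilinForm.mem_orthogonal_iff]
    intro v hv
    obtain ⟨c, rfl⟩ := Submodule.mem_span_singleton.1 hv
    have h1 : β (r u0) (r (L0 z)) = 0 := (hr _ _).trans (hL0 z)
    have h2 : β u (r (L0 z)) = 0 := by
      rcases hru with h | h
      · rwa [h] at h1
      · rw [h, map_neg, LinearMap.neg_apply, neg_eq_zero] at h1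
        exact h1
    simp [h2]
  let L : (F × (Fin n → F)) →ₗ[F] perp β u := (r.comp L0).codRestrict _ hperp
  have hL : ∀ z z', β (L z) (L z') = ((n + 2 : ℕ) : F) * (z.1 * z'.1) + dotForm F n z.2 z'.2 :=
    fun z z' => (hr _ _).trans (hLL z z')
  -- The pulled-back form ⟨t⟩ ⊕ (dot product) is nondegenerate because t ≠ 0, so the kernel is
  -- trivial. Both sides have dimension n + 1, which gives bijectivity.
  have hinj : Function.Injective L := by
    refine (injective_iff_map_eq_zero L).2 fun z hz => Prod.ext ?_ ?_
    · have := hL z (1, 0)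
      rw [hz] at this
      simp only [map_zero, LinearMap.zero_apply, ZeroMemClass.coe_zero, mul_one, add_zero] at this
      exact (mul_eq_zero.1 this.symm).resolve_left ht
    · refine (dotForm_nondegenerate n).1 _ fun w => ?_
      have := hL z (0, w)
      rw [hz] at this
      simpa using this.symm
  have hu' : u ≠ 0 := fun h => one_ne_zero (congrFun h 0)
  have hdim : Module.finrank F (F × (Fin n → F)) = Module.finrank F (perp β u) := by
    rw [LinearMap.BilinForm.finrank_orthogonal (dotForm_nondegenerate (n + 2)),
      finrank_span_singleton hu']
    simp
    omega
  exact ⟨LinearEquiv.ofInjectiveOfFinrankEq L hinj hdim, fun c w c' w' => hL (c, w) (c', w')⟩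

end Isometry

/-! ### Tensor powers as the case U = F^n with the dot product -/

section Power

variable (p : ℕ) [Fact p.Prime] {F : Type*} [Field F] [Finite F] [NeZero (2 : F)]
  [Algebra (ZMod p) F] (X : Type*) [AddCommGroup X] [Module F X] [FiniteDimensional F X]

/-- A homomorphism to a power is a family of functionals. -/
def homPi (n : ℕ) : (X →ₗ[F] (Fin n → F)) ≃ (Fin n → Module.Dual F X) where
  toFun G i := (LinearMap.proj i).comp G
  invFun y := LinearMap.pi y
  left_inv _ := rfl
  right_inv _ := rfl

/-- The functions on `Hom(X, F ^ n)` are the `n`-th tensor power of the functions on `X*`. -/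
def funPow (F : Type*) [Field F] [Finite F] (X : Type*) [AddCommGroup X] [Module F X]
    [FiniteDimensional F X] (n : ℕ) :
    (⨂[ℂ] _ : Fin n, (Module.Dual F X → ℂ)) ≃ₗ[ℂ] ((X →ₗ[F] (Fin n → F)) → ℂ) :=
  (funPiTensor _ _).trans (LinearEquiv.funCongrLeft ℂ ℂ (homPi X n))

variable {X}

theorem funPow_tprod {n : ℕ} (f : Fin n → Module.Dual F X → ℂ) (G : X →ₗ[F] (Fin n → F)) :
    funPow F X n (PiTensorProduct.tprod ℂ f) G = ∏ i, f i ((LinearMap.proj i).comp G) :=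
  funPiTensor_tprod f _

/-- The basis vector e_i shifts and pairs with the i-th component of G only, so it touches a single
tensor factor. As the e_i span F^n, this is enough for the Schur argument that identifies μ_{F^n ⊗
V}. -/
theorem weylOp_funPow {n : ℕ} (i : Fin n) (v : X × Module.Dual F X)
    (f : Fin n → Module.Dual F X → ℂ) :
    weylOp (tensorPairing X (dotForm F n)) (omega p 1) (tensorV X (Pi.single i 1 ⊗ₜ v))
        (funPow F X n (PiTensorProduct.tprod ℂ f))
      = funPow F X n (PiTensorProduct.tprod ℂ
          (Function.update f i (weylOp (evalPairing X) (omega p 1) v (f i)))) := by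
  ext G
  rw [weylOp_apply, tensorV_tmul, funPow_tprod, funPow_tprod,
    ← Finset.mul_prod_erase _ _ (Finset.mem_univ i), ← Finset.mul_prod_erase _ _ (Finset.mem_univ i),
    ← mul_assoc]
  congr 1
  · rw [Function.update_self, weylOp_apply]
    congr 1
    · congr 1
      simp only [tensorPairing_tmul, dotForm_apply, LinearMap.smulRight_apply]
      simp [Pi.single_apply]
    · congr 1
      ext x
      simp
  · refine Finset.prod_congr rfl fun j hj => ?_
    have hj := Finset.ne_of_mem_erase hj
    rw [Function.update_of_ne hj]
    congr 1
    ext x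
    simp [hj]

/-- The vector (1, …, 1) shifts every component by the same y, and the phases of the n factors
multiply up. The central part fits because the norm of (1, …, 1) is n, the number of factors that
each contribute c. There is no scalar ambiguity here. -/
theorem weyl_funPow {n : ℕ} (g : Heisenberg (evalPairing (F := F) X))
    (f : Fin n → Module.Dual F X → ℂ) :
    weyl (tensorPairing X (dotForm F n)) (omega p 1)
        (heisEmbed (dotForm_isSymm n) (fun _ => 1) g) (funPow F X n (PiTensorProduct.tprod ℂ f))
      = funPow F X n (PiTensorProduct.tprod ℂ
          fun i => weyl (evalPairing X) (omega p 1) g (f i)) := by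
  ext G
  change weyl (tensorPairing X (dotForm F n)) (omega p 1)
    ⟨dotForm F n (fun _ => 1) (fun _ => 1) * g.c, tensorV X ((fun _ => 1) ⊗ₜ g.v)⟩ _ G = _
  rw [weyl_apply, tensorV_tmul, funPow_tprod, funPow_tprod]
  simp only [weyl_apply, Finset.prod_mul_distrib]
  rw [← char_sum]
  congr 1
  · congr 1
    simp only [tensorPairing_tmul, dotForm_apply, LinearMap.smulRight_apply]
    simp [Finset.sum_sub_distrib, Finset.sum_add_distrib]
    ring
  · refine Finset.prod_congr rfl fun j _ => ?_
    congr 1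
    ext x
    simp

theorem tensorPow_tprod {G W : Type*} [Group G] [AddCommGroup W] [Module ℂ W]
    (ρ : Representation ℂ G W) (n : ℕ) (g : G) (f : Fin n → W) :
    tensorPow ρ n g (PiTensorProduct.tprod ℂ f) = PiTensorProduct.tprod ℂ fun i => ρ g (f i) :=
  PiTensorProduct.map_tprod _ _

theorem end_ext_funPow {n : ℕ} {P Q : Module.End ℂ ((X →ₗ[F] (Fin n → F)) → ℂ)}
    (h : ∀ f, P (funPow F X n (PiTensorProduct.tprod ℂ f))
      = Q (funPow F X n (PiTensorProduct.tprod ℂ f))) : P = Q := by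
  have : P ∘ₗ (funPow F X n).toLinearMap = Q ∘ₗ (funPow F X n).toLinearMap :=
    PiTensorProduct.ext (MultilinearMap.ext h)
  refine LinearMap.ext fun x => ?_
  simpa using LinearMap.congr_fun this ((funPow F X n).symm x)

/-- `μ_{F ^ n ⊗ V}` is projectively equivalent to the `n`-th tensor power of `μ_V`. -/
theorem projEquivVia_muU_dotForm (n : ℕ) :
    ProjEquivVia (funPow F X n) (tensorPow (muV p X (1 : Fˣ)) n)
      (muU p X (dotForm_isSymm n) (dotForm_nondegenerate n)) := by
  intro S
  let R : Module.End ℂ ((X →ₗ[F] (Fin n → F)) → ℂ) := (funPow F X n).toLinearMap ∘ₗ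
    (tensorPow (muV p X (1 : Fˣ)) n S) ∘ₗ (funPow F X n).symm.toLinearMap
  have hR : ∀ z, R (funPow F X n z) = funPow F X n (tensorPow (muV p X (1 : Fˣ)) n S z) :=
    fun z => by simp [R]
  have hR0 : R ≠ 0 := by
    intro h
    have : Nontrivial (⨂[ℂ] _ : Fin n, (Module.Dual F X → ℂ)) := (funPow F X n).toEquiv.nontrivial
    refine representation_ne_zero (tensorPow (muV p X (1 : Fˣ)) n) S (LinearMap.ext fun z => ?_)
    have := hR z
    rw [h, LinearMap.zero_apply, eq_comm, LinearEquiv.map_eq_zero_iff] at this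
    exact this
  -- On the standard basis vectors, intertwining reduces to that of μ_V(S) in one factor; the other
  -- factors agree trivially.
  obtain ⟨c, hc0, hc⟩ := muU_eq_smul p X (dotForm_isSymm n) (dotForm_nondegenerate n) S hR0
    (s := Set.range (Pi.basisFun F (Fin n))) (Pi.basisFun F (Fin n)).span_eq (by
      rintro _ ⟨i, rfl⟩ v
      refine end_ext_funPow fun f => ?_
      have := LinearMap.congr_fun (oscillator_intertwines (evalPairing_nondegenerate X)
        (omega_ne_one p 1) S v) (f i)
      simp only [Module.End.mul_apply] at this
      simp only [Module.End.mul_apply, Pi.basisFun_apply]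
      rw [weylOp_funPow, hR, hR, tensorPow_tprod, tensorPow_tprod, weylOp_funPow]
      congr 2
      ext1 j
      by_cases hj : j = i
      · subst hj
        rw [Function.update_self, Function.update_self]
        exact this
      · rw [Function.update_of_ne hj, Function.update_of_ne hj])
  exact ⟨c, hc0, fun z => by rw [hc, LinearMap.smul_apply, hR]⟩

/-- `Cl^{(u)}_{F ^ n ⊗ V}` for `u = (1, …, 1)` is projectively equivalent to the `n`-th tensor power
of `Cl_V`. -/
theorem projEquivVia_clU_dotForm (n : ℕ) :
    ProjEquivVia (funPow F X n) (tensorPow (clV p X (1 : Fˣ)) n)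
      (clU p X (dotForm_isSymm n) (dotForm_nondegenerate n) (fun _ => 1)) := by
  intro g
  obtain ⟨c, hc0, hc⟩ := projEquivVia_muU_dotForm p (X := X) n g.right
  refine ⟨c, hc0, fun z => ?_⟩
  rw [clU_apply, Module.End.mul_apply, hc, map_smul]
  congr 1
  -- The Heisenberg parts agree exactly, so the scalar is the one that comes from S alone.
  have : (weyl (tensorPairing X (dotForm F n)) (omega p 1)
        (heisEmbed (dotForm_isSymm n) (fun _ => 1) g.left)) ∘ₗ (funPow F X n).toLinearMap ∘ₗ
        (tensorPow (muV p X (1 : Fˣ)) n g.right)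
      = (funPow F X n).toLinearMap ∘ₗ tensorPow (clV p X (1 : Fˣ)) n g := by
    refine PiTensorProduct.ext (MultilinearMap.ext fun f => ?_)
    simp only [LinearMap.compMultilinearMap_apply, LinearMap.comp_apply, LinearEquiv.coe_coe,
      tensorPow_tprod, weyl_funPow]
    rfl
  exact LinearMap.congr_fun this z

/-- If `⟨m⟩ ⊕ F ^ n` is isometric to `U`, then the tensor product of `μ_V^{⊗ n}` and `μ_V^{(m)}` is
projectively equivalent to `μ_{U ⊗ V}`. -/
theorem projEquivVia_tprod {U : Type*} [AddCommGroup U] [Module F U] [FiniteDimensional F U]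
    {β : LinearMap.BilinForm F U} (hs : β.IsSymm) (hn : β.Nondegenerate) {n : ℕ} {m : Fˣ}
    {E : (F × (Fin n → F)) ≃ₗ[F] U}
    (hE : ∀ a w a' w', β (E (a, w)) (E (a', w')) = m * (a * a') + dotForm F n w w') :
    ProjEquivVia ((TensorProduct.comm ℂ _ _).trans ((TensorProduct.congr (LinearEquiv.refl ℂ _)
        (funPow F X n)).trans (funSplit E)))
      (Representation.tprod (tensorPow (muV p X (1 : Fˣ)) n) (muV p X m)) (muU p X hs hn) := by
  intro S
  -- The splitting puts the line of norm m first, whereas the representation has μ_V^{(m)} last;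
  -- this is the reason for the swap in the equivalence.
  obtain ⟨c, hc0, hc⟩ := muU_split p (X := X) hE hs hn (dotForm_isSymm n)
    (dotForm_nondegenerate n) S
  obtain ⟨d, hd0, hd⟩ := projEquivVia_muU_dotForm p (X := X) (F := F) n S
  refine ⟨c * d, mul_ne_zero hc0 hd0, fun z => ?_⟩
  induction z using TensorProduct.induction_on with
  | zero => simp
  | add a b ha hb => simp only [map_add, ha, hb, smul_add]
  | tmul x f =>
    simp only [LinearEquiv.trans_apply, TensorProduct.comm_tmul, TensorProduct.congr_tmul,
      LinearEquiv.refl_apply, Representation.tprod_apply, TensorProduct.map_tmul, hc, hd,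
      TensorProduct.tmul_smul, map_smul, smul_smul]

/-- The correspondence between the subrepresentations of `μ_V^{⊗ n} ⊗ μ_V^{(t)}` and of `Cl_V^{⊗ t}`
for `t = n + 2`. -/
theorem exists_orderIso_tensorPow {n t : ℕ} (hnt : t = n + 2) (ht : ¬ p ∣ t) :
    Nonempty (Subrepresentation (Representation.tprod (tensorPow (muV p X (1 : Fˣ)) n)
        (muV p X (unitOfNat p t ht : Fˣ)))
      ≃o Subrepresentation (tensorPow (clV p X (1 : Fˣ)) t)) := by
  subst hnt
  have ht0 : ((n + 2 : ℕ) : F) ≠ 0 := (unitOfNat p (F := F) (n + 2) ht).ne_zero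
  -- Every element of the prime field is a sum of two squares; the identity is then mapped into F.
  obtain ⟨a, b, hab⟩ := ZMod.sq_add_sq p ((n + 2 : ℕ) : ZMod p)
  have hab' := congrArg (algebraMap (ZMod p) F) hab
  rw [map_add, map_pow, map_pow, map_natCast] at hab'
  obtain ⟨E, hE⟩ := exists_perp_equiv hab' ht0
  have hu : dotForm F (n + 2) (fun _ => 1) (fun _ => 1) ≠ 0 := by rwa [dotForm_one]
  obtain ⟨e, -⟩ := exists_orderIso_tensorWith p (X := X) (dotForm_isSymm (F := F) (n + 2))
    (dotForm_nondegenerate (n + 2)) hu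
  -- The chain runs from μ_V^{⊗ n} ⊗ μ_V^{(t)} through μ_{u^⊥ ⊗ V} and Cl^{(u)}_{F^t ⊗ V} to Cl_V^{⊗
  -- t}. The outer links are projective equivalences, and the middle one is K ↦ L²(X*) ⊗ K.
  exact ⟨((projEquivVia_tprod p (m := unitOfNat p (n + 2) ht) (perp_isSymm (dotForm_isSymm _) _)
    (perp_nondegenerate (dotForm_isSymm _) (dotForm_nondegenerate _) hu) hE).orderIso.trans
      e).trans (projEquivVia_clU_dotForm p (n + 2)).orderIso.symm⟩

end Power

end

end OscillatorRep

open OscillatorRep in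
theorem mainTheorem6 (p : ℕ) [Fact p.Prime] {F : Type*} [Field F] [Finite F]
    [Algebra (ZMod p) F] [NeZero (2 : F)]
    {X : Type*} [AddCommGroup X] [Module F X] [FiniteDimensional F X] :
    (∀ {U : Type*} [AddCommGroup U] [Module F U] [FiniteDimensional F U]
        (β : LinearMap.BilinForm F U) (hs : β.IsSymm) (hn : β.Nondegenerate)
        (u : U) (hu : β u u ≠ 0),
      ∃ e : Subrepresentation (muU p X (perp_isSymm hs u) (perp_nondegenerate hs hn hu))
          ≃o Subrepresentation (clU p X hs hn u),
        ∀ K, (e K).toSubmodule = tensorWith X β u K.toSubmodule) ∧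
    (∀ (t : ℕ) (_ : 2 ≤ t) (ht : ¬ p ∣ t),
      ∃ e : Subrepresentation (Representation.tprod (tensorPow (muV p X (1 : Fˣ)) (t - 2))
            (muV p X (unitOfNat p t ht : Fˣ)))
          ≃o Subrepresentation (tensorPow (clV p X (1 : Fˣ)) t),
        ∀ K, IsIrreducibleSub K ↔ IsIrreducibleSub (e K)) := by
  refine ⟨fun β hs hn u hu => exists_orderIso_tensorWith p hs hn hu, fun t h2 ht => ?_⟩
  obtain ⟨e⟩ := exists_orderIso_tensorPow p (X := X) (F := F) (n := t - 2) (by omega) ht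
  exact ⟨e, isIrreducibleSub_orderIso e⟩
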